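/- Let $\ell$ be Lebesgue measure on $\mathbb R^d$, let $C_R$ be the open cube of edge length $R$ about $0$ in $\mathbb R^d$, and let $\mathbb E=\mathbb R^d\times\{1,\dots,m\}$ be the space of coloured points, on which $\mathbb R^d$ acts by $t+(x,i)=(t+x,i)$. For $\varLambda\subset\mathbb E$ and $B\subset\mathbb R^d$ put $B+\varLambda=\bigcup_{b\in B}(b+\varLambda)$ and $\varLambda^{\downarrow}=\{x:(x,i)\in\varLambda\text{ for some }i\}$. A set $\varLambda\subset\mathbb E$ is $r$-uniformly discrete if every translate $a+C_r$, $a\in\mathbb R^d$, contains at most one point of $\varLambda$, all colours taken together. Let $M_p$ be the space of point measures on $\mathbb E$ (Borel measures with values in $\mathbb N$ on relatively compact Borel sets), with the vague topology and its Borel $\sigma$-algebra. Let $r>0$ and let $\mu$ be the law of an $m$-coloured $r$-uniformly discrete stationary ergodic point process, that is, a Borel probability measure on $M_p$ that is invariant and ergodic under the translations by $\mathbb R^d$ and whose support $X$ consists of point measures giving mass at most $1$ to each $(a+C_r)\times\{1,\dots,m\}$, $a\in\mathbb R^d$. Elements of $X$ are identified with their point sets $\varLambda\subset\mathbb E$.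 The Palm measure of $\mu$ is $$\dot\mu(D)=\frac1{\ell(B)}\int_X\sum_{x\in B\cap\varLambda^{\downarrow}}\mathbf 1_D(-x+\varLambda)\,d\mu(\varLambda)$$ for Borel sets $D\subset X$, where $B\subset\mathbb R^d$ is any bounded Borel set with $\ell(B)>0$ (the value does not depend on $B$). A pattern is a pair $(F,V)$ where $F\subset\mathbb E$ is a finite $r$-uniformly discrete set with $0\in F^{\downarrow}$ and $V\subset\mathbb R^d$ is a bounded measurable neighbourhood of $0$. Put $$X_{F,V}=\{\varLambda\in X: F\subset V+\varLambda\},$$ $$L_{F,V}(\varLambda,B)=\operatorname{card}\{x\in\varLambda^{\downarrow}: F\subset -x+V+\varLambda,\ x-V+F^{\downarrow}\subset B\}.$$ Proposition 11.1. Let $(F,V)$ be a pattern. If $V$ is open, then $$\liminf_{R\to\infty}\frac{1}{\ell(C_R)}L_{F,V}(\varLambda,C_R)=\dot\mu(X_{F,V})\quad\text{for }\mu\text{-almost every }\varLambda\in X.$$ If $V$ is closed, then $$\limsup_{R\to\infty}\frac{1}{\ell(C_R)}L_{F,V}(\varLambda,C_R)=\dot\mu(X_{F,V})\quad\text{for }\mu\text{-almost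 every }\varLambda\in X.$$ -/

import Mathlib

open MeasureTheory Filter Topology Set
open scoped ENNReal

/-- The space `ℝ^d × {1, …, m}` of coloured points: `(x, i)` is the point `x` with colour `i`.
Only the topology, the bounded sets and the Lebesgue measure of `ℝ^d` are used below, so it does
not matter that the type `Fin d → ℝ` carries the sup norm. -/
abbrev ColSpace (d m : ℕ) : Type := (Fin d → ℝ) × Fin m

/-- The open cube `C_R` of edge length `R` about `0` in `ℝ^d`. -/
def openCube (d : ℕ) (R : ℝ) : Set (Fin d → ℝ) := {x | ∀ i, |x i| < R / 2}

/-- Translation `(x, i) ↦ (t + x, i)` of coloured points. -/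
def shift {d m : ℕ} (t : Fin d → ℝ) (z : ColSpace d m) : ColSpace d m := (t + z.1, z.2)

/-- The flattening `Λ^↓` of a coloured set. -/
def flatten {d m : ℕ} (Λ : Set (ColSpace d m)) : Set (Fin d → ℝ) := Prod.fst '' Λ

/-- The coloured set `B + Λ = ⋃_{b ∈ B} (b + Λ)`. -/
def setShift {d m : ℕ} (B : Set (Fin d → ℝ)) (Λ : Set (ColSpace d m)) : Set (ColSpace d m) :=
  ⋃ b ∈ B, shift b '' Λ

/-- `r`-uniformly discrete coloured sets: every translate `a + C_r` contains at most one
point of `Λ`, all colours taken together. -/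
def IsUniformlyDiscrete {d m : ℕ} (r : ℝ) (Λ : Set (ColSpace d m)) : Prop :=
  ∀ a : Fin d → ℝ, {z ∈ Λ | z.1 - a ∈ openCube d r}.encard ≤ 1

/-- Point measures on the space of coloured points: Borel measures whose values on relatively
compact Borel sets are natural numbers. -/
structure PointMeasure (d m : ℕ) where
  toMeasure : Measure (ColSpace d m)
  nat_valued : ∀ A : Set (ColSpace d m), MeasurableSet A → IsCompact (closure A) →
    ∃ n : ℕ, toMeasure A = n

namespace PointMeasure

variable {d m : ℕ}

/-- The vague topology: the coarsest one for which all `ξ ↦ ∫ f dξ` with `f` continuous and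
compactly supported are continuous. -/
noncomputable instance : TopologicalSpace (PointMeasure d m) :=
  TopologicalSpace.induced
    (fun (ξ : PointMeasure d m) (f : CompactlySupportedContinuousMap (ColSpace d m) ℝ) =>
      ∫ z, f z ∂ξ.toMeasure) inferInstance

/-- The Borel σ-algebra of the vague topology. -/
noncomputable instance : MeasurableSpace (PointMeasure d m) := borel _

instance : BorelSpace (PointMeasure d m) := ⟨rfl⟩

/-- The set of atoms of a point measure, that is, its point set. -/
def points (ξ : PointMeasure d m) : Set (ColSpace d m) := {z | ξ.toMeasure {z} ≠ 0}

theorem measurable_shift (t : Fin d → ℝ) : Measurable (shift (m := m) t) :=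
  (measurable_fst.const_add t).prodMk measurable_snd

/-- The translate `T_t ξ`, with `(T_t ξ)(A) = ξ(-t + A)`; its point set is `t + Λ`. -/
noncomputable def translate (t : Fin d → ℝ) (ξ : PointMeasure d m) : PointMeasure d m where
  toMeasure := ξ.toMeasure.map (shift t)
  nat_valued := by
    intro A hA hc
    rw [Measure.map_apply (measurable_shift t) hA]
    refine ξ.nat_valued _ (measurable_shift t hA) ?_
    have hcont : Continuous (shift (m := m) (-t)) := by unfold shift; fun_prop
    refine (hc.image hcont).of_isClosed_subset isClosed_closure ?_
    refine closure_minimal ?_ (hc.image hcont).isClosed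
    intro z hz
    exact ⟨shift t z, subset_closure hz, by simp [shift]⟩

noncomputable instance : VAdd (Fin d → ℝ) (PointMeasure d m) := ⟨translate⟩

end PointMeasure

/-- The set of point measures that give mass at most `1` to each translate `a + C_r` of the open
cube, all colours taken together. -/
def hardCore (d m : ℕ) (r : ℝ) : Set (PointMeasure d m) :=
  {ξ | ∀ a : Fin d → ℝ, ξ.toMeasure {z | z.1 - a ∈ openCube d r} ≤ 1}

/-- `μ` is the law of an `m`-coloured uniformly discrete stationary ergodic point process on
`ℝ^d` with discreteness constant `r`. (`ErgodicVAdd` contains the invariance of `μ` under all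
translations.) -/
structure IsUDErgodicLaw {d m : ℕ} (r : ℝ) (μ : Measure (PointMeasure d m)) : Prop where
  isProbabilityMeasure : IsProbabilityMeasure μ
  pos : 0 < r
  support_subset : μ.support ⊆ hardCore d m r
  ergodic : ErgodicVAdd (Fin d → ℝ) (PointMeasure d m) μ

/-- A pattern `(F, V)`: `F` is a finite `r`-uniformly discrete coloured set with a point at `0`,
and `V` is a bounded measurable neighbourhood of `0`. -/
structure IsPattern {d m : ℕ} (r : ℝ) (F : Set (ColSpace d m)) (V : Set (Fin d → ℝ)) : Prop where
  finite : F.Finite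
  uniformlyDiscrete : IsUniformlyDiscrete r F
  zero_mem : 0 ∈ flatten F
  bounded : Bornology.IsBounded V
  measurable : MeasurableSet V
  nhds_zero : V ∈ 𝓝 0

/-- The set `X_{F,V}` of those `Λ ∈ X` with `F ⊆ V + Λ`, where `X` is the support of `μ`. -/
def patternSet {d m : ℕ} (μ : Measure (PointMeasure d m)) (F : Set (ColSpace d m))
    (V : Set (Fin d → ℝ)) : Set (PointMeasure d m) :=
  {ξ ∈ μ.support | F ⊆ setShift V ξ.points}

/-- The number `L_{F,V}(Λ, B)` of the points `x ∈ Λ^↓` with `F ⊆ -x + V + Λ` and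
`x - V + F ⊆ B` (positions only). -/
noncomputable def patternCount {d m : ℕ} (F : Set (ColSpace d m)) (V : Set (Fin d → ℝ))
    (Λ : Set (ColSpace d m)) (B : Set (Fin d → ℝ)) : ℕ∞ :=
  {x ∈ flatten Λ | F ⊆ shift (-x) '' setShift V Λ ∧
    ∀ v ∈ V, ∀ f ∈ flatten F, x - v + f ∈ B}.encard

/-- The normalized count `L_{F,V}(Λ, C_R) / ℓ(C_R)`. -/
noncomputable def patternDensity {d m : ℕ} (F : Set (ColSpace d m)) (V : Set (Fin d → ℝ))
    (Λ : Set (ColSpace d m)) (R : ℝ) : ℝ≥0∞ :=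
  (patternCount F V Λ (openCube d R) : ℝ≥0∞) / volume (openCube d R)

/-- The lower frequency, in `[0, ∞]`. -/
noncomputable def lowerFreq {d m : ℕ} (F : Set (ColSpace d m)) (V : Set (Fin d → ℝ))
    (Λ : Set (ColSpace d m)) : ℝ≥0∞ :=
  liminf (fun R : ℝ => patternDensity F V Λ R) atTop

/-- The upper frequency, in `[0, ∞]`. -/
noncomputable def upperFreq {d m : ℕ} (F : Set (ColSpace d m)) (V : Set (Fin d → ℝ))
    (Λ : Set (ColSpace d m)) : ℝ≥0∞ :=
  limsup (fun R : ℝ => patternDensity F V Λ R) atTop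

/-- The (unnormalized) Palm measure of a Borel set `D` of point measures, computed with the
window `B`: `ℓ(B)⁻¹ ∫ ∑_{x ∈ B ∩ Λ^↓} 1_D(-x + Λ) dμ(Λ)`. For stationary `μ` the value does not
depend on the bounded Borel set `B` of positive Lebesgue measure. -/
noncomputable def palm {d m : ℕ} (μ : Measure (PointMeasure d m)) (B : Set (Fin d → ℝ))
    (D : Set (PointMeasure d m)) : ℝ≥0∞ :=
  (volume B)⁻¹ * ∫⁻ ξ, ∑' x : ↥(B ∩ flatten ξ.points),
    D.indicator (fun _ => (1 : ℝ≥0∞)) ((-(x : Fin d → ℝ)) +ᵥ ξ) ∂μ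

/-
The positions of the points of `Λ` at which `(F, V)` occurs form a random measure on `ℝ^d` that is
covariant under translations, and its intensity, the expected mass of the unit cube, is the Palm
value of `X_{F,V}`, for every window `B`. The mass of `[-n, n)^d`, divided by its volume, converges
almost surely: one replaces the sides `[0, 1)` of the unit cube by `[-n, n)` one after the other,
and each step is an ergodic average of averages that converge already, to which Maker's theorem
applies. By ergodicity the limit is the intensity. Finally, `L_{F,V}(Λ, C_R)` lies between the
masses of two cubes whose edge lengths differ from `R` by a bounded amount, so `L_{F,V}(Λ, C_R) /
ℓ(C_R)` has the same limit, whether `V` is open or closed.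
-/

/-! ### The pointwise ergodic theorem -/

section Birkhoff

variable {Ω : Type*} {T : Ω → Ω}

/-- The running maximum `max (0, S₁ f, …, Sₙ f)` of the Birkhoff sums of `f`, in the recursive form
`Mₙ₊₁ = max (0, f + Mₙ ∘ T)` that Garsia's proof of the maximal ergodic theorem uses. -/
noncomputable def birkhoffMax (T : Ω → Ω) (f : Ω → ℝ) : ℕ → Ω → ℝ
  | 0 => 0
  | n + 1 => fun x => max 0 (f x + birkhoffMax T f n (T x))

theorem birkhoffMax_nonneg (T : Ω → Ω) (f : Ω → ℝ) (n : ℕ) (x : Ω) : 0 ≤ birkhoffMax T f n x := by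
  cases n with
  | zero => exact le_rfl
  | succ n => exact le_max_left _ _

theorem birkhoffMax_le_succ (T : Ω → Ω) (f : Ω → ℝ) (n : ℕ) (x : Ω) :
    birkhoffMax T f n x ≤ birkhoffMax T f (n + 1) x := by
  induction n generalizing x with
  | zero => exact birkhoffMax_nonneg T f 1 x
  | succ n ih => exact max_le_max le_rfl (by linarith [ih (T x)])

theorem birkhoffSum_le_birkhoffMax (T : Ω → Ω) (f : Ω → ℝ) (n : ℕ) (x : Ω) :
    birkhoffSum T f n x ≤ birkhoffMax T f n x := by
  induction n generalizing x with
  | zero => exact le_rfl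
  | succ n ih =>
    rw [birkhoffSum_succ']
    exact le_max_of_le_right (by linarith [ih (T x)])

theorem birkhoffMax_le_add_of_pos {f : Ω → ℝ} {n : ℕ} {x : Ω} (hx : 0 < birkhoffMax T f n x) :
    birkhoffMax T f n x ≤ f x + birkhoffMax T f n (T x) := by
  cases n with
  | zero => exact absurd hx (lt_irrefl _)
  | succ n =>
    have hmax : birkhoffMax T f (n + 1) x = f x + birkhoffMax T f n (T x) :=
      max_eq_right (lt_max_iff.1 hx |>.resolve_left (lt_irrefl _)).le
    linarith [birkhoffMax_le_succ T f n (T x)]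

theorem abs_birkhoffAverage_sub_le (T : Ω → Ω) {f g h : Ω → ℝ} {x : Ω}
    (hfg : ∀ k, |f (T^[k] x) - g (T^[k] x)| ≤ h (T^[k] x)) (n : ℕ) :
    |birkhoffAverage ℝ T f n x - birkhoffAverage ℝ T g n x| ≤ birkhoffAverage ℝ T h n x := by
  simp only [birkhoffAverage, birkhoffSum, smul_eq_mul]
  rw [← mul_sub, ← Finset.sum_sub_distrib, abs_mul, abs_of_nonneg (by positivity)]
  gcongr
  exact (Finset.abs_sum_le_sum_abs _ _).trans (Finset.sum_le_sum fun k _ => hfg k)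

theorem bddAbove_range_birkhoffSum_map_iff (T : Ω → Ω) (f : Ω → ℝ) (x : Ω) :
    BddAbove (range fun n => birkhoffSum T f n (T x)) ↔
      BddAbove (range fun n => birkhoffSum T f n x) := by
  constructor
  · rintro ⟨M, hM⟩
    refine ⟨max 0 (f x + M), forall_mem_range.2 fun n => ?_⟩
    cases n with
    | zero => exact le_max_left _ _
    | succ n =>
      rw [birkhoffSum_succ']
      exact le_max_of_le_right (add_le_add_right (hM (mem_range_self n)) _)
  · rintro ⟨M, hM⟩
    refine ⟨M - f x, forall_mem_range.2 fun n => ?_⟩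
    have := hM (mem_range_self (n + 1))
    simp only [birkhoffSum_succ'] at this
    linarith

variable [MeasurableSpace Ω] {μ : Measure Ω}

theorem integrable_birkhoffMax (hT : MeasurePreserving T μ μ) {f : Ω → ℝ} (hf : Integrable f μ)
    (n : ℕ) : Integrable (birkhoffMax T f n) μ := by
  induction n with
  | zero => exact integrable_zero _ _ _
  | succ n ih => exact (integrable_zero _ _ _).sup (hf.add (hT.integrable_comp_of_integrable ih))

theorem setIntegral_birkhoffMax_pos_nonneg (hT : MeasurePreserving T μ μ) {f : Ω → ℝ}
    (hf : Integrable f μ) (n : ℕ) : 0 ≤ ∫ x in {x | 0 < birkhoffMax T f n x}, f x ∂μ := by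
  set M := birkhoffMax T f n
  have hM : Integrable M μ := integrable_birkhoffMax hT hf n
  have hMT : Integrable (fun x => M (T x)) μ := hT.integrable_comp_of_integrable hM
  have hpos : NullMeasurableSet {x | 0 < M x} μ :=
    nullMeasurableSet_lt aemeasurable_const hM.aemeasurable
  have hinv : ∫ x, M (T x) ∂μ = ∫ x, M x ∂μ := by
    rw [← integral_map hT.aemeasurable (by rw [hT.map_eq]; exact hM.aestronglyMeasurable),
      hT.map_eq]
  calc 0 = ∫ x, (M x - M (T x)) ∂μ := by rw [integral_sub hM hMT, hinv, sub_self]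
    _ ≤ ∫ x, {x | 0 < M x}.indicator f x ∂μ := by
      refine integral_mono (hM.sub hMT) (hf.indicator₀ hpos) fun x => ?_
      by_cases hx : 0 < M x
      · rw [indicator_of_mem (show x ∈ {x | 0 < M x} from hx)]
        linarith [birkhoffMax_le_add_of_pos hx]
      · rw [indicator_of_notMem (show x ∉ {x | 0 < M x} from hx)]
        linarith [birkhoffMax_nonneg T f n (T x)]
    _ = ∫ x in {x | 0 < M x}, f x ∂μ := integral_indicator₀ hpos

theorem integral_nonneg_of_ae_exists_birkhoffSum_pos (hT : MeasurePreserving T μ μ) {f : Ω → ℝ}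
    (hf : Integrable f μ) (hpos : ∀ᵐ x ∂μ, ∃ n, 0 < birkhoffSum T f n x) : 0 ≤ ∫ x, f x ∂μ := by
  set E : ℕ → Set Ω := fun n => {x | 0 < birkhoffMax T f n x}
  have hE (n : ℕ) : NullMeasurableSet (E n) μ :=
    nullMeasurableSet_lt aemeasurable_const (integrable_birkhoffMax hT hf n).aemeasurable
  have hE_mono : Monotone E :=
    monotone_nat_of_le_succ fun n x hx => lt_of_lt_of_le hx (birkhoffMax_le_succ T f n x)
  have hlim : Tendsto (fun n => ∫ x, (E n).indicator f x ∂μ) atTop (𝓝 (∫ x, f x ∂μ)) := by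
    refine tendsto_integral_of_dominated_convergence (fun x => ‖f x‖)
      (fun n => hf.aestronglyMeasurable.indicator₀ (hE n)) hf.norm
      (fun n => Eventually.of_forall fun x => norm_indicator_le_norm_self _ _) ?_
    filter_upwards [hpos] with x ⟨N, hN⟩
    refine tendsto_const_nhds.congr' ?_
    filter_upwards [eventually_ge_atTop N] with n hn
    exact (indicator_of_mem (hE_mono hn (hN.trans_le (birkhoffSum_le_birkhoffMax T f N x))) f).symm
  refine ge_of_tendsto' hlim fun n => ?_
  rw [integral_indicator₀ (hE n)]
  exact setIntegral_birkhoffMax_pos_nonneg hT hf n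

/-- The set where the Birkhoff sums of `f` are unbounded is invariant, and the maximal ergodic
theorem applies on it: it is null as soon as `f` has negative conditional expectation. -/
theorem ae_bddAbove_range_birkhoffSum [IsFiniteMeasure μ] (hT : MeasurePreserving T μ μ)
    {f : Ω → ℝ} (hfm : Measurable f) (hf : Integrable f μ)
    (hneg : ∀ᵐ x ∂μ, (μ[f | MeasurableSpace.invariants T]) x < 0) :
    ∀ᵐ x ∂μ, BddAbove (range fun n => birkhoffSum T f n x) := by
  set A : Set Ω := {x | BddAbove (range fun n => birkhoffSum T f n x)}ᶜ
  have hAm : MeasurableSet A := (measurableSet_bddAbove_range fun n =>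
    Finset.measurable_fun_sum _ fun k _ => hfm.comp (hT.measurable.iterate k)).compl
  have hAT : T ⁻¹' A = A := by
    ext x
    exact not_congr (bddAbove_range_birkhoffSum_map_iff T f x)
  have hTA : MeasurePreserving T (μ.restrict A) (μ.restrict A) := by
    simpa only [hAT] using hT.restrict_preimage hAm
  have hA_nonneg : 0 ≤ ∫ x in A, (μ[f | MeasurableSpace.invariants T]) x ∂μ := by
    rw [setIntegral_condExp (MeasurableSpace.invariants_le T) hf ⟨hAm, hAT⟩]
    refine integral_nonneg_of_ae_exists_birkhoffSum_pos hTA hf.integrableOn ?_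
    filter_upwards [ae_restrict_mem hAm] with x hx
    by_contra! hle
    exact hx ⟨0, forall_mem_range.2 hle⟩
  have hA_nonpos : ∫ x in A, (μ[f | MeasurableSpace.invariants T]) x ∂μ ≤ 0 :=
    integral_nonpos_of_ae (ae_restrict_of_ae (hneg.mono fun x hx => hx.le))
  have hA_zero : ∀ᵐ x ∂μ.restrict A, -(μ[f | MeasurableSpace.invariants T]) x = 0 := by
    refine (integral_eq_zero_iff_of_nonneg_ae
      (ae_restrict_of_ae (hneg.mono fun x hx => neg_nonneg.2 hx.le))
      integrable_condExp.neg.integrableOn).1 ?_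
    rw [integral_neg, hA_nonpos.antisymm hA_nonneg, neg_zero]
  have hA_false : ∀ᵐ _ ∂μ.restrict A, False := by
    filter_upwards [hA_zero, ae_restrict_of_ae hneg] with x h0 hlt
    linarith
  rwa [eventually_false_iff_eq_bot, ae_eq_bot, Measure.restrict_eq_zero] at hA_false

theorem ae_eventually_birkhoffAverage_lt [IsFiniteMeasure μ] (hT : MeasurePreserving T μ μ)
    {f : Ω → ℝ} (hfm : Measurable f) (hf : Integrable f μ) :
    ∀ᵐ x ∂μ, ∀ ε > 0, ∀ᶠ n in atTop,
      birkhoffAverage ℝ T f n x < (μ[f | MeasurableSpace.invariants T]) x + ε := by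
  have hle := MeasurableSpace.invariants_le T
  set e := μ[f | MeasurableSpace.invariants T]
  have hbdd (k : ℕ) : ∀ᵐ x ∂μ, BddAbove (range fun n =>
      birkhoffSum T (f - (e + fun _ => 1 / ((k : ℝ) + 1))) n x) := by
    set c : ℝ := 1 / ((k : ℝ) + 1)
    have hem : StronglyMeasurable[MeasurableSpace.invariants T] (e + fun _ => c) :=
      stronglyMeasurable_condExp.add stronglyMeasurable_const
    have hei : Integrable (e + fun _ => c) μ := integrable_condExp.add (integrable_const _)
    refine ae_bddAbove_range_birkhoffSum hT (hfm.sub (hem.mono hle).measurable) (hf.sub hei) ?_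
    filter_upwards [condExp_sub hf hei (MeasurableSpace.invariants T)] with x hx
    rw [hx, condExp_of_stronglyMeasurable hle hem hei]
    have hc : 0 < c := Nat.one_div_pos_of_nat
    simpa [e] using hc
  filter_upwards [ae_all_iff.2 hbdd] with x hx ε hε
  obtain ⟨k, hk⟩ := exists_nat_one_div_lt (half_pos hε)
  obtain ⟨M, hM⟩ := hx k
  have hM_small : ∀ᶠ n : ℕ in atTop, (n : ℝ)⁻¹ * M < ε / 2 := by
    have hlim := (tendsto_inv_atTop_nhds_zero_nat (𝕜 := ℝ)).mul_const M
    rw [zero_mul] at hlim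
    exact hlim.eventually_lt_const (half_pos hε)
  filter_upwards [hM_small, eventually_ne_atTop 0] with n hn hn0
  have hinv : (e + fun _ => 1 / ((k : ℝ) + 1)) ∘ T = e + fun _ => 1 / ((k : ℝ) + 1) :=
    MeasurableSpace.comp_eq_of_measurable_invariants
      (stronglyMeasurable_condExp.measurable.add_const _)
  have hsplit : birkhoffAverage ℝ T (f - (e + fun _ => 1 / ((k : ℝ) + 1))) n x
      = birkhoffAverage ℝ T f n x - (e x + 1 / ((k : ℝ) + 1)) := by
    rw [birkhoffAverage_sub, Pi.sub_apply, Pi.sub_apply,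
      birkhoffAverage_of_comp_eq ℝ hinv (Nat.cast_ne_zero.2 hn0), Pi.add_apply]
  have hsum : birkhoffAverage ℝ T (f - (e + fun _ => 1 / ((k : ℝ) + 1))) n x ≤ (n : ℝ)⁻¹ * M :=
    mul_le_mul_of_nonneg_left (hM (mem_range_self n)) (by positivity)
  linarith

theorem ae_tendsto_birkhoffAverage [IsFiniteMeasure μ] (hT : MeasurePreserving T μ μ) {f : Ω → ℝ}
    (hf : Integrable f μ) :
    ∀ᵐ x ∂μ, Tendsto (fun n => birkhoffAverage ℝ T f n x) atTop
      (𝓝 ((μ[f | MeasurableSpace.invariants T]) x)) := by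
  wlog hfm : Measurable f generalizing f
  · have hff' : f =ᵐ[μ] hf.aestronglyMeasurable.mk f := hf.aestronglyMeasurable.ae_eq_mk
    have havg := ae_all_iff.2 fun n =>
      hT.quasiMeasurePreserving.birkhoffAverage_ae_eq_of_ae_eq ℝ hff' n
    filter_upwards [this (hf.congr hff') hf.aestronglyMeasurable.measurable_mk, havg,
      condExp_congr_ae hff'] with x hx havg he
    rw [he]
    simpa only [havg] using hx
  filter_upwards [ae_eventually_birkhoffAverage_lt hT hfm hf,
    ae_eventually_birkhoffAverage_lt hT hfm.neg hf.neg,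
    condExp_neg f (MeasurableSpace.invariants T)] with x hupper hlower hneg
  simp only [hneg, birkhoffAverage_neg, Pi.neg_apply] at hlower
  rw [Metric.tendsto_nhds]
  intro ε hε
  filter_upwards [hupper ε hε, hlower ε hε] with n hu hl
  rw [Real.dist_eq, abs_lt]
  constructor <;> linarith

end Birkhoff

section Maker

theorem tendsto_iSup_add_nhds_zero {v : ℕ → ℝ} (hv : Tendsto v atTop (𝓝 0)) :
    Tendsto (fun k => ⨆ n, v (n + k)) atTop (𝓝 0) := by
  have hbdd (k : ℕ) : BddAbove (range fun n => v (n + k)) :=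
    ((tendsto_add_atTop_iff_nat k).2 hv).bddAbove_range
  rw [Metric.tendsto_atTop] at hv ⊢
  intro ε hε
  obtain ⟨N, hN⟩ := hv (ε / 2) (half_pos hε)
  refine ⟨N, fun k hk => ?_⟩
  have hsmall (n : ℕ) : |v (n + k)| < ε / 2 := by
    simpa [Real.dist_eq] using hN (n + k) (by omega)
  rw [Real.dist_eq, sub_zero, abs_lt]
  have hle : ⨆ n, v (n + k) ≤ ε / 2 := ciSup_le fun n => (abs_lt.1 (hsmall n)).2.le
  exact ⟨by linarith [le_ciSup (hbdd k) 0, (abs_lt.1 (hsmall 0)).1], by linarith⟩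

variable {Ω : Type*} {m m₀ : MeasurableSpace Ω} {μ : Measure Ω}

theorem exists_seq_ae_tendsto_condExp (hm : m ≤ m₀) [SigmaFinite (μ.trim hm)]
    {fs : ℕ → Ω → ℝ} {f bound : Ω → ℝ} (hfs : ∀ n, AEStronglyMeasurable (fs n) μ)
    (hbound : Integrable bound μ) (hle : ∀ n, ∀ᵐ x ∂μ, |fs n x| ≤ bound x)
    (hlim : ∀ᵐ x ∂μ, Tendsto (fun n => fs n x) atTop (𝓝 (f x))) :
    ∃ ns : ℕ → ℕ, StrictMono ns ∧
      ∀ᵐ x ∂μ, Tendsto (fun i => (μ[fs (ns i) | m]) x) atTop (𝓝 ((μ[f | m]) x)) := by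
  have hL1 := tendsto_condExpL1_of_dominated_convergence hm bound hfs hbound hle hlim
  obtain ⟨ns, hns, hae⟩ := (tendstoInMeasure_of_tendsto_Lp hL1).exists_seq_tendsto_ae
  refine ⟨ns, hns, ?_⟩
  filter_upwards [hae, condExp_ae_eq_condExpL1 hm f,
    ae_all_iff.2 fun i => condExp_ae_eq_condExpL1 hm (fs (ns i))] with x hx hf hfs
  simpa only [hf, hfs] using hx

theorem exists_forall_abs_sub_le_seq_tendsto_condExp (hm : m ≤ m₀) [SigmaFinite (μ.trim hm)]
    {G : ℕ → Ω → ℝ} {g H : Ω → ℝ} (hG : ∀ n, AEStronglyMeasurable (G n) μ)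
    (hg : AEStronglyMeasurable g μ) (hH : Integrable H μ) (hGH : ∀ n, ∀ᵐ x ∂μ, |G n x| ≤ H x)
    (hgH : ∀ᵐ x ∂μ, |g x| ≤ H x) (hlim : ∀ᵐ x ∂μ, Tendsto (fun n => G n x) atTop (𝓝 (g x))) :
    ∃ h : ℕ → Ω → ℝ, (∀ k, Integrable (h k) μ) ∧
      (∀ᵐ x ∂μ, ∀ k, ∀ n ≥ k, |G n x - g x| ≤ h k x) ∧
      ∃ ns : ℕ → ℕ, ∀ᵐ x ∂μ, Tendsto (fun i => (μ[h (ns i) | m]) x) atTop (𝓝 0) := by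
  set h : ℕ → Ω → ℝ := fun k x => ⨆ n, |G (n + k) x - g x|
  have hlim_abs : ∀ᵐ x ∂μ, Tendsto (fun n => |G n x - g x|) atTop (𝓝 0) := by
    filter_upwards [hlim] with x hx
    simpa using (hx.sub_const (g x)).abs
  have hh (k : ℕ) : AEStronglyMeasurable (h k) μ :=
    (AEMeasurable.iSup fun n => continuous_abs.measurable.comp_aemeasurable
      ((hG (n + k)).sub hg).aemeasurable).aestronglyMeasurable
  have hh_le (k : ℕ) : ∀ᵐ x ∂μ, |h k x| ≤ 2 * H x := by
    filter_upwards [ae_all_iff.2 hGH, hgH] with x hGx hgx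
    rw [abs_of_nonneg (Real.iSup_nonneg fun n => abs_nonneg _)]
    exact ciSup_le fun n => by linarith [abs_sub (G (n + k) x) (g x), hGx (n + k)]
  have hh_lim : ∀ᵐ x ∂μ, Tendsto (fun k => h k x) atTop (𝓝 0) := by
    filter_upwards [hlim_abs] with x hx
    exact tendsto_iSup_add_nhds_zero hx
  obtain ⟨ns, -, hcond⟩ :=
    exists_seq_ae_tendsto_condExp hm (f := 0) hh (hH.const_mul 2) hh_le hh_lim
  refine ⟨h, fun k => (hH.const_mul 2).mono' (hh k) (hh_le k), ?_, ns, ?_⟩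
  · filter_upwards [hlim_abs] with x hx k n hn
    have hbdd := ((tendsto_add_atTop_iff_nat k).2 hx).bddAbove_range
    simpa only [Nat.sub_add_cancel hn] using le_ciSup hbdd (n - k)
  · simpa only [condExp_zero, Pi.zero_apply] using hcond

/-- **Maker's ergodic theorem**. -/
theorem ae_tendsto_birkhoffAverage_of_tendsto [IsFiniteMeasure μ] {T : Ω → Ω}
    (hT : MeasurePreserving T μ μ) {G : ℕ → Ω → ℝ} {g H : Ω → ℝ}
    (hG : ∀ n, AEStronglyMeasurable (G n) μ) (hH : Integrable H μ)
    (hGH : ∀ n, ∀ᵐ x ∂μ, |G n x| ≤ H x)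
    (hlim : ∀ᵐ x ∂μ, Tendsto (fun n => G n x) atTop (𝓝 (g x))) :
    ∀ᵐ x ∂μ, Tendsto (fun n => birkhoffAverage ℝ T (G n) n x) atTop
      (𝓝 ((μ[g | MeasurableSpace.invariants T]) x)) := by
  have hg : AEStronglyMeasurable g μ := aestronglyMeasurable_of_tendsto_ae atTop hG hlim
  have hgH : ∀ᵐ x ∂μ, |g x| ≤ H x := by
    filter_upwards [ae_all_iff.2 hGH, hlim] with x hx hlim
    exact le_of_tendsto' hlim.abs hx
  obtain ⟨h, hh, hdiff, ns, hcond⟩ := exists_forall_abs_sub_le_seq_tendsto_condExp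
    (MeasurableSpace.invariants_le T) hG hg hH hGH hgH hlim
  have hdiff_iterate := ae_all_iff.2 fun j => (hT.iterate j).quasiMeasurePreserving.ae hdiff
  filter_upwards [hcond, ae_all_iff.2 fun k => ae_tendsto_birkhoffAverage hT (hh k),
    ae_tendsto_birkhoffAverage hT (hH.mono' hg hgH), hdiff_iterate] with x hcond hBh hBg hdiff
  have hzero : Tendsto (fun n => birkhoffAverage ℝ T (G n) n x - birkhoffAverage ℝ T g n x)
      atTop (𝓝 0) := by
    rw [Metric.tendsto_nhds]
    intro ε hε
    obtain ⟨i, hi⟩ := (hcond.eventually_lt_const hε).exists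
    filter_upwards [(hBh (ns i)).eventually_lt_const hi, eventually_ge_atTop (ns i)] with n hn hin
    rw [Real.dist_eq, sub_zero]
    exact (abs_birkhoffAverage_sub_le T (fun j => hdiff j (ns i) n hin) n).trans_lt hn
  simpa using hzero.add hBg

end Maker

section TwoSidedAverage

theorem sum_Ico_neg_eq_sum_range {M : Type*} [AddCommMonoid M] (u : ℤ → M) (n : ℕ) :
    ∑ a ∈ Finset.Ico (-n : ℤ) n, u a =
      ∑ k ∈ Finset.range n, u k + ∑ k ∈ Finset.range n, u (-(k + 1)) := by
  induction n with
  | zero => simp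
  | succ n ih =>
    have hIco : Finset.Ico (-((n + 1 : ℕ) : ℤ)) (n + 1 : ℕ) =
        insert (n : ℤ) (insert (-(n + 1) : ℤ) (Finset.Ico (-n : ℤ) n)) := by
      ext a
      simp only [Finset.mem_insert, Finset.mem_Ico]
      omega
    rw [hIco, Finset.sum_insert (by simp only [Finset.mem_insert, Finset.mem_Ico]; omega),
      Finset.sum_insert (by simp only [Finset.mem_Ico]; omega), ih, Finset.sum_range_succ,
      Finset.sum_range_succ]
    abel

variable {G Ω : Type*} [AddGroup G] [AddAction G Ω]

/-- The average of `f` over the `2n` translates `a • e +ᵥ ω`, `-n ≤ a < n`. -/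
noncomputable def twoSidedAverage (e : G) (f : Ω → ℝ) (n : ℕ) (ω : Ω) : ℝ :=
  (∑ a ∈ Finset.Ico (-n : ℤ) n, f ((a • e) +ᵥ ω)) / (2 * n)

theorem twoSidedAverage_eq_birkhoffAverage (e : G) (f : Ω → ℝ) (n : ℕ) (ω : Ω) :
    twoSidedAverage e f n ω = (birkhoffAverage ℝ (e +ᵥ ·) f n ω +
      birkhoffAverage ℝ (-e +ᵥ ·) f n (-e +ᵥ ω)) / 2 := by
  have hback (k : ℕ) : (-((k : ℤ) + 1)) • e +ᵥ ω = k • -e +ᵥ (-e +ᵥ ω) := by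
    rw [vadd_vadd, ← succ_nsmul, neg_zsmul, neg_nsmul]
    norm_cast
  simp only [twoSidedAverage, birkhoffAverage, birkhoffSum, vadd_iterate, smul_eq_mul,
    sum_Ico_neg_eq_sum_range, natCast_zsmul, hback]
  ring

theorem abs_twoSidedAverage_le {e : G} {f : Ω → ℝ} {ω : Ω} {C : ℝ}
    (hf : ∀ a : ℤ, |f (a • e +ᵥ ω)| ≤ C) (n : ℕ) : |twoSidedAverage e f n ω| ≤ C := by
  have hC : 0 ≤ C := (abs_nonneg _).trans (hf 0)
  rw [twoSidedAverage, abs_div, abs_of_nonneg (by positivity : (0 : ℝ) ≤ 2 * n)]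
  refine div_le_of_le_mul₀ (by positivity) hC ((Finset.abs_sum_le_sum_abs _ _).trans
    ((Finset.sum_le_sum fun a _ => hf a).trans_eq ?_))
  simp only [Finset.sum_const, Int.card_Ico, nsmul_eq_mul]
  rw [mul_comm, show ((n : ℤ) - -n).toNat = 2 * n by omega]
  push_cast
  ring

variable [MeasurableSpace Ω] [MeasurableConstVAdd G Ω] {μ : Measure Ω} [VAddInvariantMeasure G Ω μ]
  [IsFiniteMeasure μ]

theorem exists_ae_tendsto_twoSidedAverage (e : G) {f : ℕ → Ω → ℝ} {g H : Ω → ℝ}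
    (hf : ∀ n, AEStronglyMeasurable (f n) μ) (hH : Integrable H μ)
    (hfH : ∀ n, ∀ᵐ ω ∂μ, |f n ω| ≤ H ω)
    (hlim : ∀ᵐ ω ∂μ, Tendsto (fun n => f n ω) atTop (𝓝 (g ω))) :
    ∃ g' : Ω → ℝ, ∫ ω, g' ω ∂μ = ∫ ω, g ω ∂μ ∧
      ∀ᵐ ω ∂μ, Tendsto (fun n => twoSidedAverage e (f n) n ω) atTop (𝓝 (g' ω)) := by
  have he := measurePreserving_vadd e μ
  have hne := measurePreserving_vadd (-e) μ
  refine ⟨fun ω => ((μ[g | MeasurableSpace.invariants (e +ᵥ ·)]) ω +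
    (μ[g | MeasurableSpace.invariants (-e +ᵥ ·)]) (-e +ᵥ ω)) / 2, ?_, ?_⟩
  · have hback : ∫ ω, (μ[g | MeasurableSpace.invariants (-e +ᵥ ·)]) (-e +ᵥ ω) ∂μ =
        ∫ ω, (μ[g | MeasurableSpace.invariants (-e +ᵥ ·)]) ω ∂μ :=
      hne.integral_comp (MeasurableEquiv.vadd (-e)).measurableEmbedding _
    have hsum := integral_add (integrable_condExp (μ := μ) (f := g)
      (m := MeasurableSpace.invariants (e +ᵥ ·))) (hne.integrable_comp_of_integrable
      (integrable_condExp (f := g) (m := MeasurableSpace.invariants (-e +ᵥ ·))))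
    simp only [Function.comp_apply] at hsum
    rw [integral_div, hsum, hback,
      integral_condExp (MeasurableSpace.invariants_le _),
      integral_condExp (MeasurableSpace.invariants_le _)]
    ring
  · filter_upwards [ae_tendsto_birkhoffAverage_of_tendsto he hf hH hfH hlim,
      hne.quasiMeasurePreserving.ae
        (ae_tendsto_birkhoffAverage_of_tendsto hne hf hH hfH hlim)] with ω hω hω'
    simp only [twoSidedAverage_eq_birkhoffAverage]
    exact (hω.add hω').div_const 2

end TwoSidedAverage

/-! ### Averages of stationary random measures over cubes -/

section RandomMeasure

variable {ι Ω : Type*}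

/-- `N` is a locally finite random measure on `ℝ^ι` that is covariant under an action of `ℝ^ι` on
the sample space: translating `ω` translates `N ω`. -/
structure IsCovariantRandomMeasure [VAdd (ι → ℝ) Ω] [MeasurableSpace Ω]
    (N : Ω → Measure (ι → ℝ)) : Prop where
  measurable : Measurable N
  isFiniteMeasureOnCompacts : ∀ ω, IsFiniteMeasureOnCompacts (N ω)
  map_vadd : ∀ t ω, N (t +ᵥ ω) = (N ω).map (t + ·)

/-- The unit cube `[0, 1)^ι`. -/
def unitCube (ι : Type*) : Set (ι → ℝ) := univ.pi fun _ => Ico 0 1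

/-- The cube `[-n, n)^ι`. -/
def latticeCube (ι : Type*) (n : ℕ) : Set (ι → ℝ) := univ.pi fun _ => Ico (-n : ℝ) n

/-- The box with sides `[-n, n)` in the directions of `s` and `[0, 1)` in the others. It
interpolates between `unitCube` and `latticeCube`. -/
def partialBox [DecidableEq ι] (s : Finset ι) (n : ℕ) : Set (ι → ℝ) :=
  univ.pi fun i => if i ∈ s then Ico (-n : ℝ) n else Ico 0 1

section Boxes

variable [DecidableEq ι]

theorem partialBox_empty (n : ℕ) : partialBox (∅ : Finset ι) n = unitCube ι := by
  simp only [partialBox, unitCube, Finset.notMem_empty, if_false]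

theorem partialBox_univ [Fintype ι] (n : ℕ) :
    partialBox (Finset.univ : Finset ι) n = latticeCube ι n := by
  simp only [partialBox, latticeCube, Finset.mem_univ, if_true]

theorem measurableSet_partialBox [Countable ι] (s : Finset ι) (n : ℕ) :
    MeasurableSet (partialBox s n) :=
  MeasurableSet.univ_pi fun i => by split_ifs <;> exact measurableSet_Ico

theorem isBounded_partialBox (s : Finset ι) (n : ℕ) :
    Bornology.IsBounded (partialBox s n) :=
  Bornology.IsBounded.pi fun i => by split_ifs <;> exact Metric.isBounded_Ico _ _

theorem zsmul_single_add_mem_partialBox_iff {s : Finset ι} {i : ι} (hi : i ∉ s) {n : ℕ} {a : ℤ}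
    {x : ι → ℝ} : a • (Pi.single i (-1) : ι → ℝ) + x ∈ partialBox s n ↔
      ⌊x i⌋ = a ∧ ∀ j ≠ i, x j ∈ if j ∈ s then Ico (-n : ℝ) n else Ico 0 1 := by
  have hi_coord : (a • (Pi.single i (-1) : ι → ℝ) + x) i = x i - a := by
    simp [-zsmul_eq_mul, sub_eq_neg_add]
  have hj_coord {j : ι} (hj : j ≠ i) : (a • (Pi.single i (-1) : ι → ℝ) + x) j = x j := by
    simp [-zsmul_eq_mul, hj]
  have hfloor : x i - a ∈ Ico (0 : ℝ) 1 ↔ ⌊x i⌋ = a := by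
    rw [Int.floor_eq_iff, mem_Ico, sub_nonneg, sub_lt_iff_lt_add']
  rw [partialBox, mem_univ_pi, ← hfloor]
  constructor
  · exact fun h => ⟨by simpa only [hi_coord, hi, if_false] using h i,
      fun j hj => by simpa only [hj_coord hj] using h j⟩
  · rintro ⟨hxi, hx⟩ j
    obtain rfl | hj := eq_or_ne j i
    · simpa only [hi_coord, hi, if_false] using hxi
    · simpa only [hj_coord hj] using hx j hj

theorem partialBox_insert {s : Finset ι} {i : ι} (hi : i ∉ s) (n : ℕ) :
    partialBox (insert i s) n = ⋃ a ∈ Finset.Ico (-n : ℤ) n,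
      (a • (Pi.single i (-1) : ι → ℝ) + ·) ⁻¹' partialBox s n := by
  ext x
  have hside : x i ∈ Ico (-n : ℝ) n ↔ ⌊x i⌋ ∈ Finset.Ico (-n : ℤ) n := by
    rw [Finset.mem_Ico, Int.le_floor, Int.floor_lt]
    push_cast
    rfl
  simp only [mem_iUnion₂, mem_preimage, zsmul_single_add_mem_partialBox_iff hi, exists_prop]
  constructor
  · exact fun h => ⟨⌊x i⌋, hside.1 (by simpa using h i trivial), rfl,
      fun j hj => by simpa [hj] using h j trivial⟩
  · rintro ⟨_, ha, rfl, h⟩ j -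
    obtain rfl | hj := eq_or_ne j i
    · simpa using hside.2 ha
    · simpa [hj] using h j hj

theorem pairwiseDisjoint_preimage_partialBox {s : Finset ι} {i : ι} (hi : i ∉ s) (n : ℕ)
    (t : Set ℤ) : t.PairwiseDisjoint fun a : ℤ =>
      (a • (Pi.single i (-1) : ι → ℝ) + ·) ⁻¹' partialBox s n := by
  intro a _ b _ hab
  refine disjoint_left.2 fun x hxa hxb => hab ?_
  rw [mem_preimage, zsmul_single_add_mem_partialBox_iff hi] at hxa hxb
  exact hxa.1.symm.trans hxb.1

theorem measureReal_partialBox_insert [Finite ι] (ν : Measure (ι → ℝ))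
    [IsFiniteMeasureOnCompacts ν] {s : Finset ι} {i : ι} (hi : i ∉ s) (n : ℕ) :
    ν.real (partialBox (insert i s) n) = ∑ a ∈ Finset.Ico (-n : ℤ) n,
      ν.real ((a • (Pi.single i (-1) : ι → ℝ) + ·) ⁻¹' partialBox s n) := by
  have := Fintype.ofFinite ι
  have hfin (a : ℤ) : ν ((a • (Pi.single i (-1) : ι → ℝ) + ·) ⁻¹' partialBox s n) ≠ ∞ :=
    ((IsometryEquiv.addLeft _).isometry.antilipschitz.isBounded_preimage
      (isBounded_partialBox s n)).measure_lt_top.ne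
  rw [partialBox_insert hi]
  exact measureReal_biUnion_finset (pairwiseDisjoint_preimage_partialBox hi n _)
    (fun a _ => (measurable_const_add _) (measurableSet_partialBox s n)) fun a _ => hfin a

end Boxes

section PartialDensity

variable [AddAction (ι → ℝ) Ω] [MeasurableSpace Ω]
  {N : Ω → Measure (ι → ℝ)}

theorem IsCovariantRandomMeasure.measureReal_vadd (hN : IsCovariantRandomMeasure N) (t : ι → ℝ)
    (ω : Ω) {A : Set (ι → ℝ)} (hA : MeasurableSet A) :
    (N (t +ᵥ ω)).real A = (N ω).real ((t + ·) ⁻¹' A) := by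
  rw [hN.map_vadd, map_measureReal_apply (measurable_const_add t) hA]

theorem IsCovariantRandomMeasure.measurable_measureReal (hN : IsCovariantRandomMeasure N)
    {A : Set (ι → ℝ)} (hA : MeasurableSet A) : Measurable fun ω => (N ω).real A :=
  ((Measure.measurable_coe hA).comp hN.measurable).ennreal_toReal

variable [DecidableEq ι]

/-- The mass of `partialBox s n` relative to the number `(2n)^|s|` of unit cubes in it. -/
noncomputable def partialDensity (N : Ω → Measure (ι → ℝ)) (s : Finset ι) (n : ℕ) (ω : Ω) : ℝ :=
  (N ω).real (partialBox s n) / (2 * n) ^ s.card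

variable [Finite ι]

theorem partialDensity_insert (hN : IsCovariantRandomMeasure N) {s : Finset ι} {i : ι}
    (hi : i ∉ s) (n : ℕ) :
    partialDensity N (insert i s) n =
      twoSidedAverage (Pi.single i (-1) : ι → ℝ) (partialDensity N s n) n := by
  funext ω
  have := hN.isFiniteMeasureOnCompacts ω
  simp only [partialDensity, twoSidedAverage, measureReal_partialBox_insert _ hi,
    hN.measureReal_vadd _ _ (measurableSet_partialBox s n), Finset.card_insert_of_notMem hi,
    ← Finset.sum_div, div_div, pow_succ]

theorem measurable_partialDensity (hN : IsCovariantRandomMeasure N) (s : Finset ι) (n : ℕ) :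
    Measurable (partialDensity N s n) :=
  (hN.measurable_measureReal (measurableSet_partialBox s n)).div_const _

variable {μ : Measure Ω} {C : ℝ} [MeasurableConstVAdd (ι → ℝ) Ω] [VAddInvariantMeasure (ι → ℝ) Ω μ]

theorem ae_abs_partialDensity_le (hN : IsCovariantRandomMeasure N)
    (hC : ∀ᵐ ω ∂μ, (N ω).real (unitCube ι) ≤ C) (s : Finset ι) (n : ℕ) :
    ∀ᵐ ω ∂μ, |partialDensity N s n ω| ≤ C := by
  induction s using Finset.induction_on with
  | empty =>
    filter_upwards [hC] with ω hω
    simpa [partialDensity, partialBox_empty, abs_of_nonneg measureReal_nonneg] using hω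
  | insert i s hi ih =>
    have htranslates := ae_all_iff.2 fun a : ℤ =>
      (measurePreserving_vadd (a • (Pi.single i (-1) : ι → ℝ)) μ).quasiMeasurePreserving.ae ih
    filter_upwards [htranslates] with ω hω
    rw [partialDensity_insert hN hi]
    exact abs_twoSidedAverage_le hω n

/-- One coordinate direction of the box is averaged at a time. -/
theorem exists_ae_tendsto_partialDensity [IsFiniteMeasure μ] (hN : IsCovariantRandomMeasure N)
    (hC : ∀ᵐ ω ∂μ, (N ω).real (unitCube ι) ≤ C) (s : Finset ι) :
    ∃ g : Ω → ℝ, ∫ ω, g ω ∂μ = ∫ ω, (N ω).real (unitCube ι) ∂μ ∧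
      ∀ᵐ ω ∂μ, Tendsto (fun n => partialDensity N s n ω) atTop (𝓝 (g ω)) := by
  induction s using Finset.induction_on with
  | empty =>
    refine ⟨fun ω => (N ω).real (unitCube ι), rfl, Eventually.of_forall fun ω => ?_⟩
    simp [partialDensity, partialBox_empty]
  | insert i s hi ih =>
    obtain ⟨g, hg, hlim⟩ := ih
    obtain ⟨g', hg', hlim'⟩ := exists_ae_tendsto_twoSidedAverage (Pi.single i (-1) : ι → ℝ)
      (fun n => (measurable_partialDensity hN s n).aestronglyMeasurable) (integrable_const C)
      (ae_abs_partialDensity_le hN hC s) hlim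
    exact ⟨g', hg'.trans hg, by simpa only [partialDensity_insert hN hi] using hlim'⟩

end PartialDensity

end RandomMeasure

section Ergodic

theorem exists_ae_eq_const_of_ergodicVAdd {G Ω X : Type*} [VAdd G Ω] [MeasurableSpace Ω]
    [MeasurableSpace X] [MeasurableSpace.CountablySeparated X] [Nonempty X] {μ : Measure Ω}
    [ErgodicVAdd G Ω μ] {g : Ω → X} (hg : AEMeasurable g μ)
    (hinv : ∀ t : G, ∀ᵐ ω ∂μ, g (t +ᵥ ω) = g ω) : ∃ c, g =ᵐ[μ] Function.const Ω c := by
  refine exists_eventuallyEq_const_of_forall_separating MeasurableSet fun U hU => ?_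
  refine eventuallyConst_set.1 (aeconst_of_forall_preimage_vadd_ae_eq G
    (hg.nullMeasurableSet_preimage hU) fun t => ?_)
  filter_upwards [hinv t] with ω hω
  exact congrArg (· ∈ U) hω

variable {α : Type*} {l : Filter α} {u : ℕ → ℝ} {L : ℝ} {d : ℕ} {n : α → ℕ} {ρ : α → ℝ}

theorem tendsto_comp_div_pow_of_eventually_eq_add
    (hu : Tendsto (fun n : ℕ => u n / (2 * n) ^ d) atTop (𝓝 L)) (hn : Tendsto n l atTop)
    (hρ : Tendsto (fun a => 2 * (n a : ℝ) / ρ a) l (𝓝 1)) {n' : α → ℕ} {c : ℝ}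
    (hn' : Tendsto n' l atTop) (hc : ∀ᶠ a in l, (n' a : ℝ) = n a + c) :
    Tendsto (fun a => u (n' a) / ρ a ^ d) l (𝓝 L) := by
  have hratio : Tendsto (fun a => ((n a : ℝ) / (n a + c))⁻¹) l (𝓝 1) := by
    simpa using ((tendsto_natCast_div_add_atTop c).comp hn).inv₀ one_ne_zero
  have hlim := (hu.comp hn').mul ((hρ.mul hratio).pow d)
  rw [mul_one, one_pow, mul_one] at hlim
  refine hlim.congr' ?_
  filter_upwards [hn.eventually_gt_atTop 0, hn'.eventually_gt_atTop 0, hc] with a ha ha' hca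
  have : (n a : ℝ) ≠ 0 := by exact_mod_cast ha.ne'
  have : (n' a : ℝ) ≠ 0 := by exact_mod_cast ha'.ne'
  have hcancel : 2 * (n a : ℝ) / ρ a * (n' a / n a) = 2 * n' a / ρ a := by field_simp
  rw [← hca, Function.comp_apply, inv_div, hcancel, div_pow (2 * (n' a : ℝ)),
    div_mul_div_cancel₀ (by positivity)]

/-- A bounded error in the side length of a cube does not matter for asymptotic densities. -/
theorem tendsto_div_pow_of_le_of_le (hu : Tendsto (fun n : ℕ => u n / (2 * n) ^ d) atTop (𝓝 L))
    (hn : Tendsto n l atTop) (hρ : Tendsto (fun a => 2 * (n a : ℝ) / ρ a) l (𝓝 1)) {k : ℕ}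
    {f : α → ℝ} (hlow : ∀ᶠ a in l, u (n a - k) ≤ f a) (hup : ∀ᶠ a in l, f a ≤ u (n a + k)) :
    Tendsto (fun a => f a / ρ a ^ d) l (𝓝 L) := by
  have hsub : ∀ᶠ a in l, ((n a - k : ℕ) : ℝ) = n a + -k := by
    filter_upwards [hn.eventually_ge_atTop k] with a ha
    rw [Nat.cast_sub ha, sub_eq_add_neg]
  have hadd : ∀ᶠ a in l, ((n a + k : ℕ) : ℝ) = n a + k := Eventually.of_forall fun a => by simp
  have hpos : ∀ᶠ a in l, 0 < ρ a := by
    filter_upwards [hρ.eventually_const_lt one_pos] with a ha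
    by_contra! hneg
    exact ha.not_ge (div_nonpos_of_nonneg_of_nonpos (by positivity) hneg)
  refine tendsto_of_tendsto_of_tendsto_of_le_of_le'
    (tendsto_comp_div_pow_of_eventually_eq_add hu hn hρ ((tendsto_sub_atTop_nat k).comp hn) hsub)
    (tendsto_comp_div_pow_of_eventually_eq_add hu hn hρ ((tendsto_add_atTop_nat k).comp hn) hadd)
    ?_ ?_
  · filter_upwards [hlow, hpos] with a ha hρa
    exact div_le_div_of_nonneg_right ha (pow_pos hρa d).le
  · filter_upwards [hup, hpos] with a ha hρa
    exact div_le_div_of_nonneg_right ha (pow_pos hρa d).le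

end Ergodic

section Cubes

variable {ι : Type*}

theorem measurableSet_unitCube [Countable ι] : MeasurableSet (unitCube ι) :=
  MeasurableSet.univ_pi fun _ => measurableSet_Ico

theorem isBounded_unitCube : Bornology.IsBounded (unitCube ι) :=
  Bornology.IsBounded.pi fun _ => Metric.isBounded_Ico _ _

theorem volume_unitCube [Fintype ι] : volume (unitCube ι) = 1 := by
  simp [unitCube, volume_pi_pi]

theorem nonempty_interior_unitCube [Finite ι] : (interior (unitCube ι)).Nonempty := by
  rw [unitCube, interior_pi_set finite_univ, univ_pi_nonempty_iff]
  simp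

theorem measurableSet_latticeCube [Countable ι] (n : ℕ) : MeasurableSet (latticeCube ι n) :=
  MeasurableSet.univ_pi fun _ => measurableSet_Ico

theorem isBounded_latticeCube (n : ℕ) : Bornology.IsBounded (latticeCube ι n) :=
  Bornology.IsBounded.pi fun _ => Metric.isBounded_Ico _ _

theorem add_mem_latticeCube [Fintype ι] {x t : ι → ℝ} {n k : ℕ} (hx : x ∈ latticeCube ι n)
    (ht : ‖t‖ ≤ k) : t + x ∈ latticeCube ι (n + k) := by
  intro i _
  have hti := abs_le.1 ((norm_le_pi_norm t i).trans ht)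
  have hxi := hx i trivial
  simp only [mem_Ico, Pi.add_apply, Nat.cast_add] at hxi ⊢
  constructor <;> linarith

end Cubes

section Intensity

variable {ι Ω : Type*} [AddAction (ι → ℝ) Ω] [MeasurableSpace Ω]
  {N : Ω → Measure (ι → ℝ)} {μ : Measure Ω}

/-- The intensity of a stationary random measure: the expected mass of a unit cube. -/
noncomputable def intensity (N : Ω → Measure (ι → ℝ)) (μ : Measure Ω) : ℝ≥0∞ :=
  ∫⁻ ω, N ω (unitCube ι) ∂μ

theorem intensity_ne_top [Finite ι] [IsFiniteMeasure μ] {C : ℝ}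
    (hN : IsCovariantRandomMeasure N) (hC : ∀ᵐ ω ∂μ, (N ω).real (unitCube ι) ≤ C) :
    intensity N μ ≠ ∞ := by
  have := Fintype.ofFinite ι
  refine ne_top_of_le_ne_top (b := ∫⁻ _, ENNReal.ofReal C ∂μ) (by simp [ENNReal.mul_eq_top])
    (lintegral_mono_ae ?_)
  filter_upwards [hC] with ω hω
  have := hN.isFiniteMeasureOnCompacts ω
  rw [← ofReal_measureReal isBounded_unitCube.measure_lt_top.ne]
  exact ENNReal.ofReal_le_ofReal hω

variable [VAddInvariantMeasure (ι → ℝ) Ω μ] [MeasurableConstVAdd (ι → ℝ) Ω]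

theorem IsCovariantRandomMeasure.isAddLeftInvariant_bind
    (hN : IsCovariantRandomMeasure N) : (μ.bind N).IsAddLeftInvariant := by
  refine ⟨fun t => Measure.ext fun A hA => ?_⟩
  have hAt := measurable_const_add t hA
  rw [Measure.map_apply (measurable_const_add t) hA, Measure.bind_apply hAt
    hN.measurable.aemeasurable, Measure.bind_apply hA hN.measurable.aemeasurable]
  simp_rw [← Measure.map_apply (measurable_const_add t) hA, ← hN.map_vadd]
  exact (measurePreserving_vadd t μ).lintegral_comp
    ((Measure.measurable_coe hA).comp hN.measurable)

theorem IsCovariantRandomMeasure.lintegral_eq_intensity_mul_volume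
    [Fintype ι] (hN : IsCovariantRandomMeasure N)
    (hfin : intensity N μ ≠ ∞) {A : Set (ι → ℝ)} (hA : MeasurableSet A) :
    ∫⁻ ω, N ω A ∂μ = intensity N μ * volume A := by
  have hbind {A : Set (ι → ℝ)} (hA : MeasurableSet A) : μ.bind N A = ∫⁻ ω, N ω A ∂μ :=
    Measure.bind_apply hA hN.measurable.aemeasurable
  have hunit : μ.bind N (unitCube ι) = intensity N μ := hbind measurableSet_unitCube
  have := hN.isAddLeftInvariant_bind (μ := μ)
  have : IsFiniteMeasureOnCompacts (μ.bind N) := ⟨fun K hK =>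
    measure_lt_top_of_isCompact_of_isAddLeftInvariant' nonempty_interior_unitCube
      (hunit.trans_ne hfin) hK⟩
  have hsmul := Measure.isAddLeftInvariant_eq_smul (μ.bind N) volume
  rw [← hbind hA, ← hunit, hsmul]
  simp only [Measure.smul_apply, volume_unitCube, ENNReal.smul_def, smul_eq_mul, mul_one]

end Intensity

section ErgodicRandomMeasure

variable {ι Ω : Type*} [Fintype ι] [AddAction (ι → ℝ) Ω] [MeasurableSpace Ω]
  {N : Ω → Measure (ι → ℝ)}

theorem tendsto_latticeCube_vadd (hN : IsCovariantRandomMeasure N) {ω : Ω} {L : ℝ}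
    (hL : Tendsto (fun n : ℕ => (N ω).real (latticeCube ι n) / (2 * n) ^ Fintype.card ι) atTop
      (𝓝 L)) (t : ι → ℝ) :
    Tendsto (fun n : ℕ => (N (t +ᵥ ω)).real (latticeCube ι n) / (2 * n) ^ Fintype.card ι) atTop
      (𝓝 L) := by
  have := hN.isFiniteMeasureOnCompacts ω
  obtain ⟨k, hk⟩ := exists_nat_ge ‖t‖
  have hdiv : Tendsto (fun n : ℕ => 2 * (n : ℝ) / (2 * n)) atTop (𝓝 1) :=
    tendsto_const_nhds.congr' <| (eventually_ne_atTop 0).mono fun n hn =>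
      (div_self (mul_ne_zero two_ne_zero (Nat.cast_ne_zero.2 hn))).symm
  have hsub (n : ℕ) : (t + ·) ⁻¹' latticeCube ι n ⊆ latticeCube ι (n + k) := fun x hx => by
    simpa using add_mem_latticeCube hx ((norm_neg t).trans_le hk)
  refine tendsto_div_pow_of_le_of_le hL tendsto_id hdiv (k := k) ?_
    (Eventually.of_forall fun n => ?_)
  · filter_upwards [eventually_ge_atTop k] with n hn
    rw [hN.measureReal_vadd t ω (measurableSet_latticeCube n)]
    refine measureReal_mono (fun x hx => ?_)
      (measure_ne_top_of_subset (hsub n) (isBounded_latticeCube _).measure_lt_top.ne)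
    simpa [Nat.sub_add_cancel hn] using add_mem_latticeCube hx hk
  · rw [hN.measureReal_vadd t ω (measurableSet_latticeCube n)]
    exact measureReal_mono (hsub n) (isBounded_latticeCube _).measure_lt_top.ne

variable {μ : Measure Ω} {C : ℝ} [MeasurableConstVAdd (ι → ℝ) Ω]

theorem exists_ae_tendsto_latticeCube [IsFiniteMeasure μ] [VAddInvariantMeasure (ι → ℝ) Ω μ]
    (hN : IsCovariantRandomMeasure N) (hC : ∀ᵐ ω ∂μ, (N ω).real (unitCube ι) ≤ C) :
    ∃ g : Ω → ℝ, ∫ ω, g ω ∂μ = ∫ ω, (N ω).real (unitCube ι) ∂μ ∧ ∀ᵐ ω ∂μ,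
      Tendsto (fun n : ℕ => (N ω).real (latticeCube ι n) / (2 * n) ^ Fintype.card ι) atTop
        (𝓝 (g ω)) := by
  classical
  simpa only [partialDensity, partialBox_univ, Finset.card_univ] using
    exists_ae_tendsto_partialDensity hN hC Finset.univ

theorem ae_tendsto_latticeCube [IsProbabilityMeasure μ] [ErgodicVAdd (ι → ℝ) Ω μ]
    (hN : IsCovariantRandomMeasure N) (hC : ∀ᵐ ω ∂μ, (N ω).real (unitCube ι) ≤ C) :
    ∀ᵐ ω ∂μ, Tendsto (fun n : ℕ => (N ω).real (latticeCube ι n) / (2 * n) ^ Fintype.card ι) atTop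
      (𝓝 (intensity N μ).toReal) := by
  obtain ⟨g, hg, hlim⟩ := exists_ae_tendsto_latticeCube hN hC
  have hgm : AEMeasurable g μ := aemeasurable_of_tendsto_metrizable_ae atTop
    (fun n => ((hN.measurable_measureReal (measurableSet_latticeCube n)).div_const _).aemeasurable)
    hlim
  have hinv (t : ι → ℝ) : ∀ᵐ ω ∂μ, g (t +ᵥ ω) = g ω := by
    filter_upwards [hlim, (measurePreserving_vadd t μ).quasiMeasurePreserving.ae hlim]
      with ω hω hω'
    exact tendsto_nhds_unique hω' (tendsto_latticeCube_vadd hN hω t)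
  obtain ⟨c, hc⟩ := exists_ae_eq_const_of_ergodicVAdd hgm hinv
  have hintensity : (intensity N μ).toReal = c := by
    have hfin (ω : Ω) : N ω (unitCube ι) < ∞ :=
      have := hN.isFiniteMeasureOnCompacts ω
      isBounded_unitCube.measure_lt_top
    have hmeas : Measurable fun ω => N ω (unitCube ι) :=
      (Measure.measurable_coe measurableSet_unitCube).comp hN.measurable
    calc (intensity N μ).toReal = ∫ ω, (N ω).real (unitCube ι) ∂μ :=
          (integral_toReal hmeas.aemeasurable (Eventually.of_forall hfin)).symm
      _ = ∫ ω, g ω ∂μ := hg.symm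
      _ = c := (integral_congr_ae hc).trans (by simp)
  filter_upwards [hlim, hc] with ω hω hcω
  rwa [hintensity, ← show g ω = c from hcω]

end ErgodicRandomMeasure

/-! ### Locally finite measures -/

section LocallyFiniteMeasures

open scoped CompactlySupported

section Approximation

variable {E : Type*} [TopologicalSpace E]

theorem exists_compactlySupported_eqOn_one [RegularSpace E] [LocallyCompactSpace E] {K : Set E}
    (hK : IsCompact K) :
    ∃ h : C_c(E, ℝ), EqOn h 1 K ∧ ∀ z, 0 ≤ h z := by
  obtain ⟨h, h1, -, hc, h01⟩ := exists_continuous_one_zero_of_isCompact hK isClosed_empty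
    (disjoint_empty K)
  exact ⟨⟨h, hc⟩, h1, fun z => (h01 z).1⟩

variable [MeasurableSpace E] [BorelSpace E]

theorem abs_integral_sub_integral_le (ν : Measure E) [IsFiniteMeasureOnCompacts ν]
    {f g h : C_c(E, ℝ)} {ε : ℝ} (hfg : ∀ z, |f z - g z| ≤ ε * h z) :
    |∫ z, f z ∂ν - ∫ z, g z ∂ν| ≤ ε * ∫ z, h z ∂ν := by
  rw [← integral_sub f.integrable g.integrable, ← integral_const_mul]
  exact norm_integral_le_of_norm_le (f := fun z => f z - g z) (h.integrable.const_mul ε)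
    (.of_forall hfg)

theorem continuous_integral_of_forall_abs_sub_le {Y : Type*} [TopologicalSpace Y]
    {ν : Y → Measure E} [∀ y, IsFiniteMeasureOnCompacts (ν y)] {f h : C_c(E, ℝ)}
    (hh : Continuous fun y => ∫ z, h z ∂ν y)
    (hf : ∀ ε > 0, ∃ g : C_c(E, ℝ), (Continuous fun y => ∫ z, g z ∂ν y) ∧
      ∀ z, |f z - g z| ≤ ε * h z) :
    Continuous fun y => ∫ z, f z ∂ν y := by
  refine continuous_of_locally_uniform_approx_of_continuousAt fun y₀ u hu => ?_
  obtain ⟨ε, hε, hεu⟩ := Metric.mem_uniformity_dist.1 hu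
  set M := |∫ z, h z ∂ν y₀| + 1
  have hM : 0 < M := by positivity
  obtain ⟨g, hg, hfg⟩ := hf (ε / M) (by positivity)
  have hlt : ∀ᶠ y in 𝓝 y₀, ∫ z, h z ∂ν y < M :=
    hh.continuousAt.eventually_lt_const ((le_abs_self _).trans_lt (lt_add_one _))
  refine ⟨_, hlt, _, hg.continuousAt, fun y hy => hεu ?_⟩
  calc dist (∫ z, f z ∂ν y) (∫ z, g z ∂ν y)
      ≤ ε / M * ∫ z, h z ∂ν y := abs_integral_sub_integral_le (ν y) hfg
    _ < ε / M * M := by gcongr; exact hy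
    _ = ε := div_mul_cancel₀ _ hM.ne'

end Approximation

variable {E : Type*} [TopologicalSpace E] [LocallyCompactSpace E] [SecondCountableTopology E]

theorem exists_countable_forall_abs_sub_lt {K : Set E} (hK : IsCompact K) :
    ∃ D : Set C(E, ℝ), D.Countable ∧ (∀ g ∈ D, EqOn g 0 Kᶜ) ∧
      ∀ f : C(E, ℝ), EqOn f 0 Kᶜ → ∀ ε > 0, ∃ g ∈ D, ∀ z ∈ K, |f z - g z| < ε := by
  let S : Set C(E, ℝ) := {f | EqOn f 0 Kᶜ}
  obtain ⟨D, hD, hdense⟩ := TopologicalSpace.exists_countable_dense S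
  refine ⟨Subtype.val '' D, hD.image _, by rintro _ ⟨g, -, rfl⟩; exact g.2, fun f hf ε hε => ?_⟩
  have hopen : IsOpen {g : S | MapsTo (f - g.1) K (Metric.ball 0 ε)} :=
    (ContinuousMap.isOpen_setOfPred_mapsTo hK Metric.isOpen_ball).preimage
      (continuous_const.sub continuous_subtype_val)
  obtain ⟨g, hg, hgD⟩ := hdense.inter_open_nonempty _ hopen ⟨⟨f, hf⟩, fun z _ => by simp [hε]⟩
  exact ⟨g, mem_image_of_mem _ hgD, fun z hz => by simpa using hg hz⟩

variable [T2Space E]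

-- Uniform approximation does not suffice to approximate integrals against infinite measures;
-- the dominating function `h` controls the mass of the region where `f` and `g` differ.
theorem exists_countable_forall_abs_sub_le :
    ∃ I : Set C_c(E, ℝ), I.Countable ∧
      ∀ f : C_c(E, ℝ), ∃ h ∈ I, ∀ ε > 0, ∃ g ∈ I, ∀ z, |f z - g z| ≤ ε * h z := by
  let K : CompactExhaustion E := CompactExhaustion.choice E
  choose D hD hD0 hDf using fun n => exists_countable_forall_abs_sub_lt (K.isCompact n)
  choose h h1 h0 using fun n => exists_compactlySupported_eqOn_one (K.isCompact n)
  refine ⟨{g | ∃ n, g.toContinuousMap ∈ D n} ∪ range h, ?_, fun f => ?_⟩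
  · refine .union ?_ (countable_range h)
    simp only [ofPred_exists]
    exact countable_iUnion fun n => (hD n).preimage fun f g hfg => DFunLike.ext _ _ fun z =>
      DFunLike.congr_fun hfg z
  obtain ⟨n, hn⟩ := K.exists_superset_of_isCompact f.hasCompactSupport
  have hf0 : EqOn f 0 (K n)ᶜ := fun z hz => image_eq_zero_of_notMem_tsupport fun h => hz (hn h)
  refine ⟨h n, .inr ⟨n, rfl⟩, fun ε hε => ?_⟩
  obtain ⟨g, hgD, hfg⟩ := hDf n f.toContinuousMap hf0 ε hε
  refine ⟨⟨g, .intro (K.isCompact n) (hD0 n g hgD)⟩, .inl ⟨n, hgD⟩, fun z => ?_⟩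
  by_cases hz : z ∈ K n
  · simpa [h1 n hz] using (hfg z hz).le
  · simpa [hf0 hz, show g z = 0 from hD0 n g hgD hz] using mul_nonneg hε.le (h0 n z)

variable [MeasurableSpace E] [BorelSpace E]

theorem secondCountableTopology_induced_integral {Y : Type*} (ν : Y → Measure E)
    [∀ y, IsFiniteMeasureOnCompacts (ν y)] :
    @SecondCountableTopology Y
      (.induced (fun y (f : C_c(E, ℝ)) => ∫ z, f z ∂ν y) inferInstance) := by
  obtain ⟨I, hI, happrox⟩ := exists_countable_forall_abs_sub_le (E := E)
  have := hI.to_subtype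
  let integral : Y → C_c(E, ℝ) → ℝ := fun y f => ∫ z, f z ∂ν y
  let integralI : Y → I → ℝ := fun y f => integral y f
  suffices h : TopologicalSpace.induced integral inferInstance =
      .induced integralI inferInstance by
    exact h ▸ TopologicalSpace.secondCountableTopology_induced _ _ integralI
  refine le_antisymm ?_ ?_
  · let := TopologicalSpace.induced integral inferInstance
    have hc : Continuous integral := continuous_induced_dom
    exact continuous_iff_le_induced.1 (continuous_pi fun f => (continuous_apply f.1).comp hc)
  · let := TopologicalSpace.induced integralI inferInstance
    have hcI : ∀ f ∈ I, Continuous fun y => ∫ z, f z ∂ν y := fun f hf =>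
      (continuous_apply (⟨f, hf⟩ : I)).comp (continuous_induced_dom (f := integralI))
    refine continuous_iff_le_induced.1 (continuous_pi fun f => ?_)
    obtain ⟨h, hh, hg⟩ := happrox f
    refine continuous_integral_of_forall_abs_sub_le (hcI h hh) fun ε hε => ?_
    obtain ⟨g, hgI, hfg⟩ := hg ε hε
    exact ⟨g, hcI g hgI, hfg⟩

theorem exists_tendsto_integral_measureReal {K : Set E} (hK : IsCompact K) :
    ∃ f : ℕ → C_c(E, ℝ), ∀ (ν : Measure E) [IsFiniteMeasureOnCompacts ν],
      Tendsto (fun k => ∫ z, f k z ∂ν) atTop (𝓝 (ν.real K)) := by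
  let := TopologicalSpace.metrizableSpaceMetric E
  obtain ⟨h, h1, h0⟩ := exists_compactlySupported_eqOn_one hK
  refine ⟨fun k => ⟨⟨fun z => (hK.isClosed.apprSeq k z : ℝ) * h z, by fun_prop⟩,
    h.hasCompactSupport.mul_left⟩, fun ν _ => ?_⟩
  rw [← integral_indicator_one hK.measurableSet]
  refine tendsto_integral_of_dominated_convergence h
    (fun k => Continuous.aestronglyMeasurable (by fun_prop)) h.integrable
    (fun k => .of_forall fun z => ?_) (.of_forall fun z => ?_)
  · change |(hK.isClosed.apprSeq k z : ℝ) * h z| ≤ h z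
    rw [abs_of_nonneg (mul_nonneg NNReal.zero_le_coe (h0 z))]
    exact mul_le_of_le_one_left (h0 z)
      (mod_cast HasOuterApproxClosed.apprSeq_apply_le_one hK.isClosed k z)
  · have hlim := tendsto_pi_nhds.1 (HasOuterApproxClosed.tendsto_apprSeq hK.isClosed) z
    have hind : K.indicator (1 : E → ℝ) z = (K.indicator (fun _ => 1) z : NNReal) * h z := by
      by_cases hz : z ∈ K
      · simp [hz, h1 hz]
      · simp [hz]
    exact hind ▸ (NNReal.tendsto_coe.2 hlim).mul_const (h z)

variable {Ω : Type*} [MeasurableSpace Ω]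

theorem measurable_measure_of_isCompact {ν : Ω → Measure E} [∀ ω, IsFiniteMeasureOnCompacts (ν ω)]
    (hν : ∀ f : C_c(E, ℝ), Measurable fun ω => ∫ z, f z ∂ν ω) {K : Set E} (hK : IsCompact K) :
    Measurable fun ω => ν ω K := by
  obtain ⟨f, hf⟩ := exists_tendsto_integral_measureReal hK
  have hreal : Measurable fun ω => (ν ω).real K :=
    measurable_of_tendsto_metrizable (fun k => hν (f k)) (tendsto_pi_nhds.2 fun ω => hf (ν ω))
  simpa only [ofReal_measureReal hK.measure_lt_top.ne] using hreal.ennreal_ofReal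

theorem measurable_of_measurable_integral {ν : Ω → Measure E}
    [∀ ω, IsFiniteMeasureOnCompacts (ν ω)]
    (hν : ∀ f : C_c(E, ℝ), Measurable fun ω => ∫ z, f z ∂ν ω) : Measurable ν := by
  let K : CompactExhaustion E := CompactExhaustion.choice E
  have hrestrict : ∀ n, Measurable fun ω => (ν ω).restrict (K n) := fun n => by
    have : ∀ ω, IsFiniteMeasure ((ν ω).restrict (K n)) := fun ω =>
      ⟨by simpa using (K.isCompact n).measure_lt_top⟩
    refine Measurable.measure_of_isPiSystem (S := {F | IsClosed F})
      (by rw [← borel_eq_generateFrom_isClosed, BorelSpace.measurable_eq (α := E)])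
      isPiSystem_isClosed (fun F hF => ?_) ?_
    · simp_rw [Measure.restrict_apply (IsClosed.measurableSet hF)]
      exact measurable_measure_of_isCompact hν ((K.isCompact n).inter_left hF)
    · simp_rw [Measure.restrict_apply_univ]
      exact measurable_measure_of_isCompact hν (K.isCompact n)
  refine Measure.measurable_of_measurable_coe _ fun A hA => ?_
  have hsup : ∀ ω, ν ω A = ⨆ n, (ν ω).restrict (K n) A := fun ω => by
    simp_rw [Measure.restrict_apply hA]
    rw [← Monotone.measure_iUnion fun i j hij => inter_subset_inter_right A (K.subset hij),
      ← inter_iUnion, K.iUnion_eq, inter_univ]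
  simp_rw [hsup]
  exact .iSup fun n => (Measure.measurable_coe hA).comp (hrestrict n)

end LocallyFiniteMeasures

section SFiniteKernels

open ProbabilityTheory

variable {Ω E : Type*} [MeasurableSpace Ω] [MeasurableSpace E]

theorem isSFiniteKernel_of_isFiniteMeasure (κ : Kernel Ω E) [∀ ω, IsFiniteMeasure (κ ω)] :
    IsSFiniteKernel κ := by
  classical
  have hS : ∀ n : ℕ, MeasurableSet {ω | ⌈(κ ω univ).toReal⌉₊ = n} := fun n =>
    (Nat.measurable_ceil.comp (κ.measurable_coe .univ).ennreal_toReal) (measurableSet_singleton n)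
  have hfinite : ∀ n, IsFiniteKernel (Kernel.piecewise (hS n) κ 0) := fun n => by
    refine ⟨n, ENNReal.natCast_lt_top n, fun ω => ?_⟩
    rw [Kernel.piecewise_apply]
    split_ifs with h
    · rw [← ENNReal.ofReal_toReal (measure_ne_top (κ ω) univ), ← ENNReal.ofReal_natCast]
      exact ENNReal.ofReal_le_ofReal ((Nat.le_ceil _).trans_eq (congrArg _ h))
    · simp
  convert (inferInstance : IsSFiniteKernel (Kernel.sum fun n => Kernel.piecewise (hS n) κ 0))
  ext ω A hA
  rw [Kernel.sum_apply' _ _ hA, tsum_eq_single ⌈(κ ω univ).toReal⌉₊ fun n hn => ?_]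
  · simp [Kernel.piecewise_apply]
  · simp [Kernel.piecewise_apply, hn.symm]

theorem isSFiniteKernel_of_iUnion_eq_univ (κ : Kernel Ω E) {K : ℕ → Set E}
    (hKm : ∀ n, MeasurableSet (K n)) (hK : ⋃ n, K n = univ) (hfin : ∀ ω n, κ ω (K n) ≠ ∞) :
    IsSFiniteKernel κ := by
  have hm := MeasurableSet.disjointed hKm
  have hsf : ∀ n, IsSFiniteKernel (κ.restrict (hm n)) := fun n => by
    have : ∀ ω, IsFiniteMeasure (κ.restrict (hm n) ω) := fun ω => ⟨by
      rw [Kernel.restrict_apply, Measure.restrict_apply_univ]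
      exact (measure_mono (disjointed_subset K n)).trans_lt (hfin ω n).lt_top⟩
    exact isSFiniteKernel_of_isFiniteMeasure _
  convert (inferInstance : IsSFiniteKernel (Kernel.sum fun n => κ.restrict (hm n)))
  ext ω A hA
  rw [Kernel.sum_apply' _ _ hA]
  simp_rw [Kernel.restrict_apply, Measure.restrict_apply hA]
  rw [← measure_iUnion
    (fun i j h => (disjoint_disjointed _ h).mono inter_subset_right inter_subset_right)
    (fun n => hA.inter (hm n)), ← inter_iUnion, iUnion_disjointed, hK, inter_univ]

end SFiniteKernels

theorem vadd_mem_support {G Ω : Type*} [VAdd G Ω] [TopologicalSpace Ω] [ContinuousConstVAdd G Ω]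
    [MeasurableSpace Ω] [BorelSpace Ω] {μ : Measure Ω} [VAddInvariantMeasure G Ω μ] (t : G)
    {ω : Ω} (hω : ω ∈ μ.support) : t +ᵥ ω ∈ μ.support := by
  rw [Measure.mem_support_iff_forall] at hω ⊢
  intro U hU
  have hpos := hω _ ((continuous_const_vadd t).continuousAt (interior_mem_nhds.2 hU))
  rw [VAddInvariantMeasure.measure_preimage_vadd t isOpen_interior.measurableSet] at hpos
  exact hpos.trans_le (measure_mono interior_subset)

/-! ### Point measures -/

section ColouredPoints

variable {d m : ℕ}

theorem continuous_shift (t : Fin d → ℝ) : Continuous (shift (m := m) t) := by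
  unfold shift; fun_prop

theorem shift_zero : shift (m := m) (0 : Fin d → ℝ) = id := by ext z <;> simp [shift]

theorem shift_add (s t : Fin d → ℝ) : shift (m := m) (s + t) = shift s ∘ shift t := by
  ext z <;> simp [shift, add_assoc]

/-- Translation of coloured points as a homeomorphism. -/
def shiftHomeomorph (t : Fin d → ℝ) : ColSpace d m ≃ₜ ColSpace d m where
  toFun := shift t
  invFun := shift (-t)
  left_inv z := by simp [shift]
  right_inv z := by simp [shift]
  continuous_toFun := continuous_shift t
  continuous_invFun := continuous_shift (-t)

theorem setShift_image_shift (V : Set (Fin d → ℝ)) (t : Fin d → ℝ) (Λ : Set (ColSpace d m)) :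
    setShift V (shift t '' Λ) = shift t '' setShift V Λ := by
  simp only [setShift, image_iUnion, image_image, shift, add_left_comm t]

theorem isOpen_openCube (R : ℝ) : IsOpen (openCube d R) := by
  simp only [openCube, ofPred_forall]
  exact isOpen_iInter_of_finite fun i => isOpen_lt (by fun_prop) continuous_const

theorem zero_mem_openCube {R : ℝ} (hR : 0 < R) : 0 ∈ openCube d R := fun i => by simpa using hR

end ColouredPoints

namespace PointMeasure

open ProbabilityTheory
open scoped CompactlySupported

variable {d m : ℕ}

@[ext]
theorem ext {ξ η : PointMeasure d m} (h : ξ.toMeasure = η.toMeasure) : ξ = η := by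
  cases ξ; cases η; congr

instance (ξ : PointMeasure d m) : IsFiniteMeasureOnCompacts ξ.toMeasure := by
  refine ⟨fun K hK => ?_⟩
  obtain ⟨n, hn⟩ := ξ.nat_valued K hK.measurableSet (by rwa [hK.isClosed.closure_eq])
  exact hn ▸ ENNReal.natCast_lt_top n

theorem toMeasure_vadd (t : Fin d → ℝ) (ξ : PointMeasure d m) :
    (t +ᵥ ξ).toMeasure = ξ.toMeasure.map (shift t) := rfl

noncomputable instance : AddAction (Fin d → ℝ) (PointMeasure d m) where
  zero_vadd ξ := by ext1; rw [toMeasure_vadd, shift_zero, Measure.map_id]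
  add_vadd s t ξ := by
    ext1
    rw [toMeasure_vadd, toMeasure_vadd, toMeasure_vadd, shift_add,
      Measure.map_map (measurable_shift s) (measurable_shift t)]

theorem continuous_integral (f : C_c(ColSpace d m, ℝ)) :
    Continuous fun ξ : PointMeasure d m => ∫ z, f z ∂ξ.toMeasure :=
  (continuous_apply f).comp (continuous_induced_dom
    (f := fun (ξ : PointMeasure d m) (f : C_c(ColSpace d m, ℝ)) => ∫ z, f z ∂ξ.toMeasure))

instance : ContinuousConstVAdd (Fin d → ℝ) (PointMeasure d m) where
  continuous_const_vadd t := by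
    refine continuous_induced_rng.2 (continuous_pi fun f => ?_)
    let g : C_c(ColSpace d m, ℝ) :=
      ⟨⟨fun z => f (shift t z), f.continuous.comp (continuous_shift t)⟩,
        f.hasCompactSupport.comp_homeomorph (shiftHomeomorph t)⟩
    exact (continuous_integral g).congr fun ξ => (integral_map (measurable_shift t).aemeasurable
      f.continuous.aestronglyMeasurable).symm

instance : SecondCountableTopology (PointMeasure d m) :=
  secondCountableTopology_induced_integral toMeasure

theorem measurable_toMeasure :
    Measurable (toMeasure : PointMeasure d m → Measure (ColSpace d m)) :=
  measurable_of_measurable_integral fun f => (continuous_integral f).measurable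

/-- The map `ξ ↦ ξ` as a kernel from point measures to coloured points. -/
noncomputable def kernel (d m : ℕ) : Kernel (PointMeasure d m) (ColSpace d m) :=
  ⟨toMeasure, measurable_toMeasure⟩

instance : IsSFiniteKernel (kernel d m) :=
  let K := CompactExhaustion.choice (ColSpace d m)
  isSFiniteKernel_of_iUnion_eq_univ _ (fun n => (K.isCompact n).measurableSet) K.iUnion_eq
    fun ξ n => ((K.isCompact n).measure_lt_top (μ := ξ.toMeasure)).ne

section Atoms

variable (ξ : PointMeasure d m) {A : Set (ColSpace d m)}

theorem measure_eq_zero_of_lt_one (hA : MeasurableSet A) (hc : IsCompact (closure A))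
    (h : ξ.toMeasure A < 1) : ξ.toMeasure A = 0 := by
  obtain ⟨n, hn⟩ := ξ.nat_valued A hA hc
  rw [hn] at h ⊢
  exact_mod_cast Nat.lt_one_iff.1 (by exact_mod_cast h)

theorem measure_ne_zero_iff (hA : MeasurableSet A) :
    ξ.toMeasure A ≠ 0 ↔ (A ∩ ξ.points).Nonempty := by
  refine ⟨fun h => ?_, fun ⟨z, hzA, hz⟩ h0 =>
    hz (measure_mono_null (singleton_subset_iff.2 hzA) h0)⟩
  by_contra hempty
  obtain ⟨K, hKA, hK, hpos⟩ := hA.exists_lt_isCompact (pos_iff_ne_zero.2 h)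
  refine hpos.ne' (hK.measure_zero_of_nhdsWithin fun z hz => ?_)
  have hz0 : ξ.toMeasure {z} = 0 := by
    by_contra hz0
    exact hempty ⟨z, hKA hz, hz0⟩
  obtain ⟨U, hzU, hU, hU1⟩ := exists_isOpen_lt_of_lt {z} 1 (hz0.trans_lt one_pos)
  refine ⟨U ∩ K, inter_mem (mem_nhdsWithin_of_mem_nhds (hU.mem_nhds (hzU rfl)))
    self_mem_nhdsWithin, ?_⟩
  exact ξ.measure_eq_zero_of_lt_one (hU.measurableSet.inter hK.measurableSet)
    (hK.closure_of_subset inter_subset_right) ((measure_mono inter_subset_left).trans_lt hU1)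

theorem countable_points : ξ.points.Countable := by
  simpa only [points, pos_iff_ne_zero] using
    Measure.countable_meas_pos_of_disjoint_iUnion (μ := ξ.toMeasure)
      (As := fun z : ColSpace d m => {z}) measurableSet_singleton
      (fun _ _ h => disjoint_singleton.2 h)

theorem measure_eq_tsum (hA : MeasurableSet A) :
    ξ.toMeasure A = ∑' z : ↥(A ∩ ξ.points), ξ.toMeasure {(z : ColSpace d m)} := by
  have hp := ξ.countable_points
  have hdiff : ξ.toMeasure (A \ ξ.points) = 0 := by
    by_contra h
    obtain ⟨z, hz, hz'⟩ := (ξ.measure_ne_zero_iff (hA.diff hp.measurableSet)).1 h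
    exact hz.2 hz'
  rw [← measure_inter_add_sdiff (μ := ξ.toMeasure) A hp.measurableSet, hdiff, add_zero]
  simpa using lintegral_countable (μ := ξ.toMeasure) (fun _ => 1) (hp.mono inter_subset_right)

theorem points_vadd (t : Fin d → ℝ) : (t +ᵥ ξ).points = shift t '' ξ.points := by
  have himage : shift t '' ξ.points = shift (-t) ⁻¹' ξ.points :=
    (shiftHomeomorph t).image_eq_preimage_symm _
  have hpreimage (z : ColSpace d m) : shift t ⁻¹' {z} = {shift (-t) z} :=
    ((shiftHomeomorph t).toEquiv.image_symm_eq_preimage {z}).symm.trans image_singleton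
  ext z
  rw [himage, points, mem_ofPred_eq, toMeasure_vadd,
    Measure.map_apply (measurable_shift t) (measurableSet_singleton z), hpreimage]
  rfl

end Atoms

section HardCore

variable {r : ℝ} {ξ : PointMeasure d m}

theorem measure_singleton_eq_one (hr : 0 < r) (hξ : ξ ∈ hardCore d m r) {z : ColSpace d m}
    (hz : z ∈ ξ.points) : ξ.toMeasure {z} = 1 := by
  refine le_antisymm ((measure_mono ?_).trans (hξ z.1)) ?_
  · rintro _ rfl
    simpa using zero_mem_openCube hr
  · by_contra! hlt
    exact hz (ξ.measure_eq_zero_of_lt_one (measurableSet_singleton z) (by simp) hlt)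

theorem injOn_fst_points (hr : 0 < r) (hξ : ξ ∈ hardCore d m r) : InjOn Prod.fst ξ.points := by
  intro z hz w hw hzw
  by_contra hne
  have hpair : ξ.toMeasure ({z} ∪ {w}) ≤ 1 := by
    refine (measure_mono ?_).trans (hξ z.1)
    rintro y (rfl | rfl)
    · simpa using zero_mem_openCube hr
    · simpa [hzw] using zero_mem_openCube hr
  rw [measure_union (disjoint_singleton.2 hne) (measurableSet_singleton w),
    measure_singleton_eq_one hr hξ hz, measure_singleton_eq_one hr hξ hw] at hpair
  norm_num at hpair

theorem measure_eq_encard (hr : 0 < r) (hξ : ξ ∈ hardCore d m r) {A : Set (ColSpace d m)}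
    (hA : MeasurableSet A) : ξ.toMeasure A = ((A ∩ ξ.points).encard : ℝ≥0∞) := by
  rw [measure_eq_tsum ξ hA, ← ENNReal.tsum_set_one]
  exact tsum_congr fun z => measure_singleton_eq_one hr hξ z.2.2

theorem exists_forall_measure_le (hr : 0 < r) {A : Set (Fin d → ℝ)} (hA : Bornology.IsBounded A) :
    ∃ k : ℕ, ∀ ξ ∈ hardCore d m r, ξ.toMeasure (Prod.fst ⁻¹' A) ≤ k := by
  obtain ⟨t, -, ht⟩ := hA.isCompact_closure.elim_nhds_subcover
    (fun a => {x | x - a ∈ openCube d r})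
    (fun a _ => ((isOpen_openCube r).preimage (continuous_id.sub continuous_const)).mem_nhds
      (by simpa using zero_mem_openCube hr))
  refine ⟨t.card, fun ξ hξ => ?_⟩
  calc ξ.toMeasure (Prod.fst ⁻¹' A)
      ≤ ξ.toMeasure (⋃ a ∈ t, {z | z.1 - a ∈ openCube d r}) :=
        measure_mono fun z hz => by simpa using ht (subset_closure hz)
    _ ≤ ∑ a ∈ t, ξ.toMeasure {z | z.1 - a ∈ openCube d r} := measure_biUnion_finset_le _ _
    _ ≤ ∑ _ ∈ t, 1 := Finset.sum_le_sum fun a _ => hξ a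
    _ = t.card := by simp

end HardCore

end PointMeasure

/-! ### Occurrences of a pattern -/

section Occurs

variable {d m : ℕ} {F : Set (ColSpace d m)} {V : Set (Fin d → ℝ)} {Λ : Set (ColSpace d m)}
  {x : Fin d → ℝ}

/-- The pattern `(F, V)` occurs in `Λ` at the position `x`, that is, `F ⊆ -x + V + Λ`. The position
is not required to be a point of `Λ`. -/
def Occurs (F : Set (ColSpace d m)) (V : Set (Fin d → ℝ)) (Λ : Set (ColSpace d m))
    (x : Fin d → ℝ) : Prop :=
  F ⊆ shift (-x) '' setShift V Λ

theorem occurs_iff_subset_setShift : Occurs F V Λ x ↔ F ⊆ setShift V (shift (-x) '' Λ) := by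
  rw [Occurs, setShift_image_shift]

theorem occurs_image_shift_add (t : Fin d → ℝ) :
    Occurs F V (shift t '' Λ) (t + x) ↔ Occurs F V Λ x := by
  rw [Occurs, Occurs, setShift_image_shift, ← image_comp, ← shift_add, neg_add_rev,
    neg_add_cancel_right]

theorem occurs_iff_forall_exists :
    Occurs F V Λ x ↔ ∀ f ∈ F, ∃ z ∈ Λ, z.2 = f.2 ∧ x + f.1 - z.1 ∈ V := by
  refine forall₂_congr fun f _ => ?_
  simp only [setShift, image_iUnion, image_image, mem_iUnion, mem_image]
  constructor
  · rintro ⟨v, hv, z, hz, rfl⟩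
    exact ⟨z, hz, rfl, by simpa [shift] using hv⟩
  · rintro ⟨z, hz, hcol, hv⟩
    exact ⟨_, hv, z, hz, Prod.ext (by simp [shift]) hcol⟩

end Occurs

namespace PointMeasure

open ProbabilityTheory

variable {d m : ℕ} {F : Set (ColSpace d m)} {V : Set (Fin d → ℝ)}

theorem occurs_points_iff (hV : MeasurableSet V) {ξ : PointMeasure d m} {x : Fin d → ℝ} :
    Occurs F V ξ.points x ↔
      ∀ f ∈ F, ξ.toMeasure {z | z.2 = f.2 ∧ x + f.1 - z.1 ∈ V} ≠ 0 := by
  refine occurs_iff_forall_exists.trans (forall₂_congr fun f _ => ?_)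
  have hmeas : MeasurableSet {z : ColSpace d m | z.2 = f.2 ∧ x + f.1 - z.1 ∈ V} :=
    (measurable_snd (measurableSet_singleton f.2)).inter
      (hV.preimage (measurable_fst.const_sub (x + f.1)))
  rw [ξ.measure_ne_zero_iff hmeas]
  exact exists_congr fun z => and_comm

theorem measurableSet_occurs (hF : F.Countable) (hV : MeasurableSet V) :
    MeasurableSet {p : PointMeasure d m × (Fin d → ℝ) | Occurs F V p.1.points p.2} := by
  simp only [occurs_points_iff hV, ofPred_forall]
  refine MeasurableSet.biInter hF fun f _ => ?_
  have hmatch : MeasurableSet {q : (PointMeasure d m × (Fin d → ℝ)) × ColSpace d m |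
      q.2.2 = f.2 ∧ q.1.2 + f.1 - q.2.1 ∈ V} :=
    ((measurable_snd.comp measurable_snd) (measurableSet_singleton f.2)).inter
      (hV.preimage (by fun_prop))
  have hmass := Kernel.measurable_kernel_prodMk_left
    (κ := Kernel.prodMkRight (Fin d → ℝ) (kernel d m)) hmatch
  exact (hmass (measurableSet_singleton 0)).compl

theorem measurableSet_occurs_points (hF : F.Countable) (hV : MeasurableSet V)
    (ξ : PointMeasure d m) : MeasurableSet {x | Occurs F V ξ.points x} :=
  measurable_prodMk_left (measurableSet_occurs hF hV)

/-- The random measure on `ℝ^d` that counts the positions `x ∈ Λ^↓` at which the pattern `(F, V)`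
occurs, each with the total mass that `ξ` gives to the colours at `x`. -/
noncomputable def occMeasure (F : Set (ColSpace d m)) (V : Set (Fin d → ℝ))
    (ξ : PointMeasure d m) : Measure (Fin d → ℝ) :=
  (ξ.toMeasure.restrict (Prod.fst ⁻¹' {x | Occurs F V ξ.points x})).map Prod.fst

theorem occMeasure_apply (ξ : PointMeasure d m) {A : Set (Fin d → ℝ)} (hA : MeasurableSet A) :
    occMeasure F V ξ A = ξ.toMeasure (Prod.fst ⁻¹' (A ∩ {x | Occurs F V ξ.points x})) := by
  rw [occMeasure, Measure.map_apply measurable_fst hA, Measure.restrict_apply (measurable_fst hA),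
    preimage_inter]

theorem occMeasure_le (ξ : PointMeasure d m) {A : Set (Fin d → ℝ)} (hA : MeasurableSet A) :
    occMeasure F V ξ A ≤ ξ.toMeasure (Prod.fst ⁻¹' A) := by
  rw [occMeasure_apply ξ hA]
  exact measure_mono (preimage_mono inter_subset_left)

theorem measurable_occMeasure (hF : F.Countable) (hV : MeasurableSet V) :
    Measurable (occMeasure F V) := by
  refine Measure.measurable_of_measurable_coe _ fun A hA => ?_
  simp_rw [occMeasure_apply _ hA]
  have hpos : Measurable fun p : PointMeasure d m × ColSpace d m => (p.1, p.2.1) := by fun_prop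
  exact Kernel.measurable_kernel_prodMk_left (κ := kernel d m)
    (((measurable_fst.comp measurable_snd) hA).inter (hpos (measurableSet_occurs hF hV)))

theorem isCovariantRandomMeasure_occMeasure (hF : F.Countable) (hV : MeasurableSet V) :
    IsCovariantRandomMeasure (occMeasure F V) where
  measurable := measurable_occMeasure hF hV
  isFiniteMeasureOnCompacts ξ := ⟨fun K hK => (occMeasure_le ξ hK.measurableSet).trans_lt <| by
    simpa only [prod_univ] using (hK.prod isCompact_univ).measure_lt_top⟩
  map_vadd t ξ := by
    have hpreimage : shift t ⁻¹' (Prod.fst ⁻¹' {x | Occurs F V (t +ᵥ ξ).points x}) =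
        (Prod.fst ⁻¹' {x | Occurs F V ξ.points x} : Set (ColSpace d m)) := by
      ext z
      rw [mem_preimage, mem_preimage, mem_ofPred_eq, points_vadd]
      exact occurs_image_shift_add t
    rw [occMeasure, toMeasure_vadd, Measure.restrict_map (measurable_shift t)
      (measurable_fst (measurableSet_occurs_points hF hV _)), hpreimage,
      Measure.map_map measurable_fst (measurable_shift t), occMeasure,
      Measure.map_map (measurable_const_add t) measurable_fst]
    rfl

section HardCore

variable {r : ℝ} {ξ : PointMeasure d m} {A : Set (Fin d → ℝ)}

theorem exists_forall_occMeasure_real_le (hr : 0 < r) (hA : MeasurableSet A)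
    (hAb : Bornology.IsBounded A) :
    ∃ C : ℝ, ∀ ξ ∈ hardCore d m r, (occMeasure F V ξ).real A ≤ C := by
  obtain ⟨k, hk⟩ := exists_forall_measure_le (m := m) hr hAb
  exact ⟨k, fun ξ hξ => ENNReal.toReal_le_of_le_ofReal k.cast_nonneg <| by
    simpa using (occMeasure_le ξ hA).trans (hk ξ hξ)⟩

theorem occMeasure_eq_encard (hF : F.Countable) (hV : MeasurableSet V) (hr : 0 < r)
    (hξ : ξ ∈ hardCore d m r) (hA : MeasurableSet A) : occMeasure F V ξ A =
      ((A ∩ flatten ξ.points ∩ {x | Occurs F V ξ.points x}).encard : ℝ≥0∞) := by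
  rw [occMeasure_apply ξ hA, measure_eq_encard hr hξ
    (measurable_fst (hA.inter (measurableSet_occurs_points hF hV ξ))),
    ← ((injOn_fst_points hr hξ).mono inter_subset_right).encard_image, image_preimage_inter,
    inter_right_comm, flatten]

theorem tsum_indicator_patternSet {μ : Measure (PointMeasure d m)}
    [VAddInvariantMeasure (Fin d → ℝ) (PointMeasure d m) μ] (hF : F.Countable)
    (hV : MeasurableSet V) (hr : 0 < r) (hξ : ξ ∈ hardCore d m r) (hsupp : ξ ∈ μ.support)
    (hA : MeasurableSet A) :
    ∑' x : ↥(A ∩ flatten ξ.points), (patternSet μ F V).indicator (fun _ => (1 : ℝ≥0∞))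
      ((-(x : Fin d → ℝ)) +ᵥ ξ) = occMeasure F V ξ A := by
  have hpreimage : (fun x : Fin d → ℝ => -x +ᵥ ξ) ⁻¹' patternSet μ F V =
      {x | Occurs F V ξ.points x} := by
    ext x
    rw [mem_ofPred_eq, occurs_iff_subset_setShift, ← points_vadd]
    exact and_iff_right (vadd_mem_support (-x) hsupp)
  have hindicator (x : Fin d → ℝ) :
      (patternSet μ F V).indicator (fun _ => (1 : ℝ≥0∞)) (-x +ᵥ ξ) =
        {x | Occurs F V ξ.points x}.indicator (fun _ => 1) x := by
    rw [← hpreimage]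
    rfl
  simp_rw [hindicator]
  rw [tsum_subtype (A ∩ flatten ξ.points) ({x | Occurs F V ξ.points x}.indicator fun _ => 1),
    indicator_indicator, ← tsum_subtype, ENNReal.tsum_set_one, occMeasure_eq_encard hF hV hr hξ hA]

end HardCore

end PointMeasure

section Law

open PointMeasure

variable {d m : ℕ} {r : ℝ} {μ : Measure (PointMeasure d m)} {F : Set (ColSpace d m)}
  {V B : Set (Fin d → ℝ)}

theorem IsUDErgodicLaw.ae_mem_hardCore (hμ : IsUDErgodicLaw r μ) : ∀ᵐ ξ ∂μ, ξ ∈ hardCore d m r :=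
  mem_of_superset Measure.support_mem_ae hμ.support_subset

theorem IsUDErgodicLaw.exists_ae_occMeasure_real_le (hμ : IsUDErgodicLaw r μ) :
    ∃ C : ℝ, ∀ᵐ ξ ∂μ, (occMeasure F V ξ).real (unitCube (Fin d)) ≤ C := by
  obtain ⟨C, hC⟩ :=
    exists_forall_occMeasure_real_le hμ.pos measurableSet_unitCube isBounded_unitCube
  exact ⟨C, hμ.ae_mem_hardCore.mono hC⟩

theorem IsUDErgodicLaw.intensity_occMeasure_ne_top (hμ : IsUDErgodicLaw r μ) (hF : F.Countable)
    (hV : MeasurableSet V) : intensity (occMeasure F V) μ ≠ ∞ := by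
  have := hμ.isProbabilityMeasure
  obtain ⟨C, hC⟩ := hμ.exists_ae_occMeasure_real_le (F := F) (V := V)
  exact intensity_ne_top (isCovariantRandomMeasure_occMeasure hF hV) hC

theorem IsUDErgodicLaw.palm_patternSet_eq_intensity (hμ : IsUDErgodicLaw r μ) (hF : F.Countable)
    (hV : MeasurableSet V) (hBm : MeasurableSet B) (hB₀ : volume B ≠ 0) (hB : volume B ≠ ∞) :
    palm μ B (patternSet μ F V) = intensity (occMeasure F V) μ := by
  have := hμ.ergodic.toVAddInvariantMeasure
  have hsum : ∀ᵐ ξ ∂μ, ∑' x : ↥(B ∩ flatten ξ.points),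
      (patternSet μ F V).indicator (fun _ => (1 : ℝ≥0∞)) (-(x : Fin d → ℝ) +ᵥ ξ) =
        occMeasure F V ξ B := by
    filter_upwards [Measure.support_mem_ae] with ξ hξ
    exact tsum_indicator_patternSet hF hV hμ.pos (hμ.support_subset hξ) hξ hBm
  rw [palm, lintegral_congr_ae hsum,
    (isCovariantRandomMeasure_occMeasure hF hV).lintegral_eq_intensity_mul_volume
      (hμ.intensity_occMeasure_ne_top hF hV) hBm, mul_left_comm, ENNReal.inv_mul_cancel hB₀ hB,
    mul_one]

end Law

/-! ### Counting occurrences in large cubes -/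

section Counting

open PointMeasure

variable {d m k : ℕ} {r : ℝ} {F : Set (ColSpace d m)} {V A B : Set (Fin d → ℝ)}
  {ξ : PointMeasure d m}

theorem volume_openCube {R : ℝ} (hR : 0 ≤ R) :
    volume (openCube d R) = ENNReal.ofReal (R ^ d) := by
  have hpi : openCube d R = univ.pi fun _ : Fin d => Ioo (-(R / 2)) (R / 2) := by
    ext x
    simp only [openCube, mem_ofPred_eq, abs_lt, mem_univ_pi, mem_Ioo]
  rw [hpi, volume_pi_pi]
  simp [ENNReal.ofReal_pow hR]

theorem openCube_subset_latticeCube (R : ℝ) :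
    openCube d R ⊆ latticeCube (Fin d) (⌊R / 2⌋₊ + 1) := by
  intro x hx i _
  have hxi := (hx i).trans (Nat.lt_floor_add_one (R / 2))
  rw [← Nat.cast_add_one, abs_lt] at hxi
  exact ⟨hxi.1.le, hxi.2⟩

theorem latticeCube_subset_openCube {n : ℕ} {R : ℝ} (hn : n < R / 2) :
    latticeCube (Fin d) n ⊆ openCube d R :=
  fun _ hx i => (abs_le.2 ⟨(hx i trivial).1, (hx i trivial).2.le⟩).trans_lt hn

theorem occMeasure_le_patternCount (hF : F.Countable) (hV : MeasurableSet V) (hr : 0 < r)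
    (hξ : ξ ∈ hardCore d m r) (hA : MeasurableSet A)
    (hAB : ∀ x ∈ A, ∀ v ∈ V, ∀ f ∈ flatten F, f - v + x ∈ B) :
    occMeasure F V ξ A ≤ patternCount F V ξ.points B := by
  rw [occMeasure_eq_encard hF hV hr hξ hA]
  refine ENat.toENNReal_le.2 (encard_le_encard ?_)
  rintro x ⟨⟨hxA, hx⟩, hocc⟩
  refine ⟨hx, hocc, fun v hv f hf => ?_⟩
  rw [sub_add_eq_add_sub, add_comm, ← sub_add_eq_add_sub]
  exact hAB x hxA v hv f hf

theorem patternCount_le_occMeasure (hF : F.Countable) (hne : F.Nonempty) (hV : MeasurableSet V)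
    (hr : 0 < r) (hξ : ξ ∈ hardCore d m r) (hA : MeasurableSet A)
    (hBA : ∀ x ∈ B, ∀ v ∈ V, ∀ f ∈ flatten F, v - f + x ∈ A) :
    patternCount F V ξ.points B ≤ occMeasure F V ξ A := by
  rw [occMeasure_eq_encard hF hV hr hξ hA]
  refine ENat.toENNReal_le.2 (encard_le_encard ?_)
  rintro x ⟨hx, hocc, hB⟩
  obtain ⟨f, hf⟩ := hne
  obtain ⟨z, -, -, hv⟩ := occurs_iff_forall_exists.1 hocc f hf
  have hfF : f.1 ∈ flatten F := mem_image_of_mem _ hf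
  refine ⟨⟨?_, hx⟩, hocc⟩
  simpa using hBA _ (hB _ hv _ hfF) _ hv _ hfF

theorem patternCount_openCube_le (hF : F.Countable) (hne : F.Nonempty) (hV : MeasurableSet V)
    (hr : 0 < r) (hξ : ξ ∈ hardCore d m r) (hk : ∀ v ∈ V, ∀ f ∈ flatten F, ‖v - f‖ ≤ k) (R : ℝ) :
    patternCount F V ξ.points (openCube d R) ≤
      occMeasure F V ξ (latticeCube (Fin d) (⌊R / 2⌋₊ + 1 + k)) :=
  patternCount_le_occMeasure hF hne hV hr hξ (measurableSet_latticeCube _) fun _ hx v hv f hf =>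
    add_mem_latticeCube (openCube_subset_latticeCube R hx) (hk v hv f hf)

theorem le_patternCount_openCube (hF : F.Countable) (hV : MeasurableSet V) (hr : 0 < r)
    (hξ : ξ ∈ hardCore d m r) (hk : ∀ v ∈ V, ∀ f ∈ flatten F, ‖v - f‖ ≤ k) {R : ℝ}
    (hR : k < ⌊R / 2⌋₊) : occMeasure F V ξ (latticeCube (Fin d) (⌊R / 2⌋₊ - (k + 1))) ≤
      patternCount F V ξ.points (openCube d R) :=
  occMeasure_le_patternCount hF hV hr hξ (measurableSet_latticeCube _) fun _ hx v hv f hf =>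
    latticeCube_subset_openCube (Nat.lt_of_lt_floor (by lia))
      (add_mem_latticeCube hx (norm_sub_rev v f ▸ hk v hv f hf))

theorem tendsto_two_mul_floor_half_div :
    Tendsto (fun R : ℝ => 2 * (⌊R / 2⌋₊ : ℝ) / R) atTop (𝓝 1) := by
  refine (tendsto_nat_floor_div_atTop.comp (tendsto_id.atTop_div_const two_pos)).congr fun R => ?_
  simp only [Function.comp_apply, id_eq]
  rw [div_div_eq_mul_div, mul_comm]

theorem tendsto_patternDensity (hF : F.Countable) (hne : F.Nonempty)
    (hFb : Bornology.IsBounded (flatten F)) (hV : MeasurableSet V) (hVb : Bornology.IsBounded V)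
    (hr : 0 < r) (hξ : ξ ∈ hardCore d m r) {L : ℝ}
    (hL : Tendsto (fun n : ℕ => (occMeasure F V ξ).real (latticeCube (Fin d) n) / (2 * n) ^ d)
      atTop (𝓝 L)) :
    Tendsto (fun R => patternDensity F V ξ.points R) atTop (𝓝 (ENNReal.ofReal L)) := by
  have := (isCovariantRandomMeasure_occMeasure hF hV).isFiniteMeasureOnCompacts ξ
  have hfin (n : ℕ) : occMeasure F V ξ (latticeCube (Fin d) n) ≠ ∞ :=
    (isBounded_latticeCube n).measure_lt_top.ne
  obtain ⟨K, hK⟩ := (hVb.sub hFb).exists_norm_le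
  obtain ⟨k, hKk⟩ := exists_nat_ge K
  have hk : ∀ v ∈ V, ∀ f ∈ flatten F, ‖v - f‖ ≤ k :=
    fun v hv f hf => (hK _ (sub_mem_sub hv hf)).trans hKk
  have hupper := patternCount_openCube_le hF hne hV hr hξ hk
  have hcount (R : ℝ) := ne_top_of_le_ne_top (hfin _) (hupper R)
  have hfloor : Tendsto (fun R : ℝ => ⌊R / 2⌋₊) atTop atTop :=
    tendsto_nat_floor_atTop.comp (tendsto_id.atTop_div_const two_pos)
  have hlim : Tendsto
      (fun R : ℝ => (patternCount F V ξ.points (openCube d R) : ℝ≥0∞).toReal / R ^ d)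
      atTop (𝓝 L) := by
    refine tendsto_div_pow_of_le_of_le hL hfloor tendsto_two_mul_floor_half_div (k := k + 1) ?_ ?_
    · filter_upwards [hfloor.eventually_gt_atTop k] with R hR
      exact ENNReal.toReal_mono (hcount R) (le_patternCount_openCube hF hV hr hξ hk hR)
    · refine .of_forall fun R => ?_
      rw [add_comm k, ← add_assoc]
      exact ENNReal.toReal_mono (hfin _) (hupper R)
  refine (ENNReal.tendsto_ofReal hlim).congr' ?_
  filter_upwards [eventually_gt_atTop 0] with R hR
  rw [patternDensity, volume_openCube hR.le, ENNReal.ofReal_div_of_pos (pow_pos hR d),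
    ENNReal.ofReal_toReal (hcount R)]

end Counting

theorem proposition11p1_general {d m : ℕ} {r : ℝ} {μ : Measure (PointMeasure d m)}
    (hμ : IsUDErgodicLaw r μ) {F : Set (ColSpace d m)} (hF : F.Countable) (hne : F.Nonempty)
    (hFb : Bornology.IsBounded (flatten F)) {V : Set (Fin d → ℝ)} (hV : MeasurableSet V)
    (hVb : Bornology.IsBounded V) {B : Set (Fin d → ℝ)} (hBm : MeasurableSet B)
    (hB₀ : volume B ≠ 0) (hB : volume B ≠ ∞) :
    ∀ᵐ ξ ∂μ, Tendsto (fun R => patternDensity F V ξ.points R) atTop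
      (𝓝 (palm μ B (patternSet μ F V))) := by
  have := hμ.isProbabilityMeasure
  have := hμ.ergodic
  obtain ⟨C, hC⟩ := hμ.exists_ae_occMeasure_real_le (F := F) (V := V)
  rw [hμ.palm_patternSet_eq_intensity hF hV hBm hB₀ hB,
    ← ENNReal.ofReal_toReal (hμ.intensity_occMeasure_ne_top hF hV)]
  filter_upwards [hμ.ae_mem_hardCore,
    ae_tendsto_latticeCube (PointMeasure.isCovariantRandomMeasure_occMeasure hF hV) hC]
    with ξ hξ hlim
  exact tendsto_patternDensity hF hne hFb hV hVb hμ.pos hξ (by simpa using hlim)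

theorem proposition11p1 {d m : ℕ} (r : ℝ) (μ : Measure (PointMeasure d m))
    (hμ : IsUDErgodicLaw r μ) (F : Set (ColSpace d m)) (V : Set (Fin d → ℝ))
    (hFV : IsPattern r F V)
    (B : Set (Fin d → ℝ)) (hBm : MeasurableSet B) (hBb : Bornology.IsBounded B)
    (hB : volume B ≠ 0) :
    (IsOpen V → ∀ᵐ ξ ∂μ, lowerFreq F V ξ.points = palm μ B (patternSet μ F V)) ∧
    (IsClosed V → ∀ᵐ ξ ∂μ, upperFreq F V ξ.points = palm μ B (patternSet μ F V)) := by
  have hlim := proposition11p1_general hμ hFV.finite.countable (image_nonempty.1 ⟨0, hFV.zero_mem⟩)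
    (hFV.finite.image Prod.fst).isBounded hFV.measurable hFV.bounded hBm hB hBb.measure_lt_top.ne
  exact ⟨fun _ => hlim.mono fun _ h => h.liminf_eq, fun _ => hlim.mono fun _ h => h.limsup_eq⟩
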